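/- A transcendental entire function is an entire function that is not a polynomial. For a family $\mathcal F$ of entire functions, $F(\mathcal F)\subset\mathbb C$ denotes its Fatou set, the largest open set on which $\mathcal F$ is normal (limits $\infty$ allowed); $F(f)$ is the Fatou set of the family of iterates $\{f^n : n\ge 1\}$, and for a semigroup $G$ of entire functions under composition, $F(G)$ is the Fatou set of the family $G$. Such a semigroup $G$ is called nearly abelian if there is a precompact family $\Phi$ of affine maps $z\mapsto \alpha z+\beta$, $\alpha\neq 0$ (every sequence in $\Phi$ has a subsequence converging locally uniformly on $\mathbb C$ to an affine map with nonzero linear coefficient), such that $\phi(F(G))=F(G)$ for every $\phi\in\Phi$, and for all $h,k\in G$ there is $\phi\in\Phi$ with $h\circ k=\phi\circ k\circ h$. The commutator set $\Phi(G)$ is the set of affine maps $\phi$ such that $h\circ k=\phi\circ k\circ h$ for some $h,k\in G$. Theorem. Let $f$ and $g$ be transcendental entire functions with $g=af+b$, where $a\in\mathbb C\setminus\{0\}$ and $b>0$ is real. Suppose that the semigroup $G=\langle f,g\rangle$ is nearly abelian and that every element of its commutator set $\Phi(G)$ is a real translation $z\mapsto z+c$, $c\in\mathbb R$. Then $F(f)=F(g)$,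 and $|a|=1$. -/

import Mathlib

open Filter Topology

/-- A transcendental entire function: holomorphic on all of `ℂ` and not a polynomial. -/
def IsTranscendentalEntire (f : ℂ → ℂ) : Prop :=
  Differentiable ℂ f ∧ ¬ ∃ p : Polynomial ℂ, ∀ z, f z = p.eval z

/-- The semigroup `⟨S⟩` of self-maps of `ℂ` generated by `S`, the operation being composition
(which is the multiplication of `Function.End ℂ`); all nonempty words in `S`. -/
def generatedSemigroup (S : Set (ℂ → ℂ)) : Set (ℂ → ℂ) :=
  {h | (show Function.End ℂ from h) ∈
    Subsemigroup.closure (show Set (Function.End ℂ) from S)}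

/-- The maps `u n` tend to `∞` uniformly on every compact subset of `U`. -/
def TendstoInftyLocallyUniformlyOn (u : ℕ → ℂ → ℂ) (U : Set ℂ) : Prop :=
  ∀ K : Set ℂ, K ⊆ U → IsCompact K → ∀ M : ℝ, ∀ᶠ n in atTop, ∀ z ∈ K, M ≤ ‖u n z‖

/-- Normality of a family of entire functions on a domain (connected open set) `U`: every sequence
of the family has a subsequence that converges locally uniformly on `U`, either to a finite
(hence holomorphic) function or to `∞`. -/
def IsNormalOn (𝓕 : Set (ℂ → ℂ)) (U : Set ℂ) : Prop :=
  ∀ u : ℕ → ℂ → ℂ, (∀ n, u n ∈ 𝓕) → ∃ k : ℕ → ℕ, StrictMono k ∧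
    ((∃ η : ℂ → ℂ, TendstoLocallyUniformlyOn (fun n => u (k n)) η atTop U) ∨
      TendstoInftyLocallyUniformlyOn (fun n => u (k n)) U)

/-- The Fatou set of a family: the largest open set on which the family is normal. Normality being
a local property, this is the set of centres of discs on which the family is normal. -/
def fatouSet (𝓕 : Set (ℂ → ℂ)) : Set ℂ :=
  {z | ∃ r : ℝ, 0 < r ∧ IsNormalOn 𝓕 (Metric.ball z r)}

/-- The Fatou set `F(f)` of a single function: that of the family of its iterates. -/
def fatouSetOf (f : ℂ → ℂ) : Set ℂ :=
  fatouSet {h | ∃ n : ℕ, 1 ≤ n ∧ h = f^[n]}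

/-- Affine maps `z ↦ α z + β` with `α ≠ 0`. -/
def IsAffineMap (φ : ℂ → ℂ) : Prop :=
  ∃ α β : ℂ, α ≠ 0 ∧ ∀ z, φ z = α * z + β

/-- A precompact family of affine maps: every sequence in it has a subsequence converging locally
uniformly on `ℂ` to an affine map. -/
def IsPrecompactAffineFamily (Φ : Set (ℂ → ℂ)) : Prop :=
  (∀ φ ∈ Φ, IsAffineMap φ) ∧
    ∀ u : ℕ → ℂ → ℂ, (∀ n, u n ∈ Φ) → ∃ k : ℕ → ℕ, StrictMono k ∧
      ∃ ψ : ℂ → ℂ, IsAffineMap ψ ∧ TendstoLocallyUniformly (fun n => u (k n)) ψ atTop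

/-- Nearly abelian semigroups of entire functions. -/
def IsNearlyAbelian (G : Set (ℂ → ℂ)) : Prop :=
  ∃ Φ : Set (ℂ → ℂ), IsPrecompactAffineFamily Φ ∧
    (∀ φ ∈ Φ, φ '' fatouSet G = fatouSet G) ∧
    ∀ h ∈ G, ∀ k ∈ G, ∃ φ ∈ Φ, h ∘ k = φ ∘ k ∘ h

/-- The commutator set `Φ(G)`: the affine maps `φ` with `h ∘ k = φ ∘ k ∘ h` for some `h, k ∈ G`. -/
def semigroupCommutatorSet (G : Set (ℂ → ℂ)) : Set (ℂ → ℂ) :=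
  {φ | IsAffineMap φ ∧ ∃ h ∈ G, ∃ k ∈ G, h ∘ k = φ ∘ k ∘ h}

/-!
Write `L w = a w + b`, so that `g = L ∘ f`. The commutator of `f^[n]` with `g` is a translation by a
real number `c n`, and cancelling `f` gives `f^[n] ∘ L = L ∘ f^[n] + c n`. The numbers `c n` are
bounded because the commutators lie in a precompact family
(`IsNearlyAbelian.exists_real_translation`).

For `n = 1` the relation makes `f'` invariant under `L`. If `‖a‖ ≠ 1`, then `L` or its inverse
contracts to a fixed point and `f'` is constant, which is absurd; so `‖a‖ = 1`. Comparing the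
relations for `n` and `n + 1` shows that every `c n` is a pseudo-period:
`f (v + c n) = f v + c (n + 1) - c 1`. If `c 1 = 0` and `a ≠ 1`, the iterates of `g` are those of
`f` followed by powers of the rotation `L`, and the Fatou sets agree
(`fatouSetOf_eq_of_rotation`). If `c 1 ≠ 0` and `a` is not real, `f'` has the two periods `c 1` and
`a * c 1` and is constant. There remain `a = 1`, and `a = -1` with `c 1 ≠ 0`. In these cases there is
a real `x ≠ 0` with `f (v + x) = f v + l x`, and the `l ^ n * x` are bounded pseudo-periods. They
cannot accumulate at `0`, so `l ∈ {0, 1, -1}`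
(`eq_zero_or_one_or_neg_one_of_pseudoperiods`). Then the iterates of `g` are those of `f` up to
bounded isometries and multiples of `x`.

The multiples of `x` may be unbounded when `l = ±1`, as for `z + sin z` and `z + sin z + 2π`, and this
is the heart of the matter (`fatouSetOf_subset_of_int_translate`). The Julia set of `f` is invariant
under translation by `x`, and `f` maps its Fatou set into itself. So if `p` is in the Julia set, all
iterates of `f`, and all their translates by multiples of `x`, omit `p + ℤ x` on a disc in the Fatou
set. By Montel's theorem they form a normal family. Here Montel's theorem
(`exists_subseq_of_ne_int`) is obtained by writing a function omitting the integers as `cosh u ^ 2`: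
then `u` omits points within distance `4` of every point of the plane, and Bloch's theorem
(`exists_ball_subset_image_ball`) bounds `u'`. The same argument gives Picard's little theorem.

That the Julia set is not empty (`exists_notMem_fatouSetOf`) is seen as follows for `f` commuting
with a translation. By Picard's theorem `f` or `f ∘ f` has a fixed point, hence many. If the Fatou
set were the plane, the iterates would be locally bounded, and comparing a limit of the iterates
`f^[n]` with a limit of the `f^[m - n]` would show that `f` is injective, hence affine.
-/

/-! ### Bloch's theorem -/

open Metric in
theorem norm_deriv_le_of_norm_le_on_ball {f : ℂ → ℂ} {z w : ℂ} {R M : ℝ} (hR : 0 < R)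
    (hf : DifferentiableOn ℂ f (ball z R)) (hM : ∀ x ∈ ball z R, ‖f x‖ ≤ M)
    (hw : w ∈ closedBall z (R / 2)) : ‖deriv f w‖ ≤ M / (R / 4) := by
  have hsub : closedBall w (R / 4) ⊆ ball z R := by
    apply closedBall_subset_ball'
    have := mem_closedBall.1 hw
    linarith
  apply Complex.norm_deriv_le_of_forall_mem_sphere_norm_le (by positivity)
  · apply DifferentiableOn.diffContOnCl
    rw [closure_ball _ (by positivity)]
    exact hf.mono hsub
  · intro x hx
    exact hM x (hsub (sphere_subset_closedBall hx))

open Metric in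
theorem norm_sub_le_of_norm_le_on_ball {f : ℂ → ℂ} {z x y : ℂ} {R M : ℝ} (hR : 0 < R)
    (hf : DifferentiableOn ℂ f (ball z R)) (hM : ∀ x ∈ ball z R, ‖f x‖ ≤ M)
    (hx : x ∈ closedBall z (R / 2)) (hy : y ∈ closedBall z (R / 2)) :
    ‖f y - f x‖ ≤ M / (R / 4) * ‖y - x‖ := by
  apply (convex_closedBall z (R / 2)).norm_image_sub_le_of_norm_deriv_le _ _ hx hy
  · intro w hw
    exact (hf.differentiableAt (isOpen_ball.mem_nhds
      (closedBall_subset_ball (by linarith) hw)))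
  · intro w hw
    exact norm_deriv_le_of_norm_le_on_ball hR hf hM hw

open Metric in
/-- The quantitative step behind Bloch's theorem: if the derivative does not exceed twice its
modulus at the centre, the image contains a disc of definite size around the image of the centre. -/
theorem ball_subset_image_of_norm_deriv_le_two_mul {f : ℂ → ℂ} {z : ℂ} {r : ℝ} (hr : 0 < r)
    (hf : DifferentiableOn ℂ f (ball z r)) (hz : deriv f z ≠ 0)
    (hd : ∀ w ∈ ball z r, ‖deriv f w‖ ≤ 2 * ‖deriv f z‖) :
    ball (f z) (‖deriv f z‖ * r / 64) ⊆ f '' ball z r := by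
  set A := ‖deriv f z‖ with hA
  have hA0 : 0 < A := norm_pos_iff.2 hz
  have hf' : DifferentiableOn ℂ (deriv f) (ball z r) := hf.deriv isOpen_ball
  have hat : ∀ w ∈ ball z r, DifferentiableAt ℂ f w := fun w hw =>
    hf.differentiableAt (isOpen_ball.mem_nhds hw)
  have hzr : z ∈ closedBall z (r / 2) := mem_closedBall_self (by positivity)
  have h1 : ∀ w ∈ closedBall z (r / 2), ‖deriv f w - deriv f z‖ ≤ 8 * A / r * ‖w - z‖ := by
    intro w hw
    have := norm_sub_le_of_norm_le_on_ball hr hf' hd hzr hw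
    convert this using 2
    field_simp; ring
  set s := r / 16 with hs
  have h2 : ∀ w ∈ closedBall z s, ‖deriv f w - deriv f z‖ ≤ A / 2 := by
    intro w hw
    have hw' := mem_closedBall_iff_norm.1 hw
    refine (h1 w (closedBall_subset_closedBall (by rw [hs]; linarith) hw)).trans ?_
    calc 8 * A / r * ‖w - z‖ ≤ 8 * A / r * (r / 16) := by gcongr
      _ = A / 2 := by field_simp; norm_num
  have hsub : closedBall z s ⊆ ball z r := closedBall_subset_ball (by rw [hs]; linarith)
  have h3 : ∀ w ∈ closedBall z s, ‖(f w - deriv f z * w) - (f z - deriv f z * z)‖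
      ≤ A / 2 * ‖w - z‖ := by
    intro w hw
    have key := (convex_closedBall z s).norm_image_sub_le_of_norm_deriv_le
      (f := fun w => f w - deriv f z * w) (C := A / 2) (x := z) (y := w) ?_ ?_
      (mem_closedBall_self (by positivity)) hw
    · exact key
    · intro x hx
      exact (hat x (hsub hx)).sub (by fun_prop)
    · intro x hx
      have : deriv (fun w => f w - deriv f z * w) x = deriv f x - deriv f z := by
        have hd1 : HasDerivAt (fun w => f w - deriv f z * w) (deriv f x - deriv f z * 1) x :=
          (hat x (hsub hx)).hasDerivAt.sub ((hasDerivAt_id x).const_mul (deriv f z))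
        rw [hd1.deriv, mul_one]
      rw [this]
      exact h2 x hx
  have h4 : ∀ w ∈ sphere z s, A * r / 32 ≤ ‖f w - f z‖ := by
    intro w hw
    have hws : ‖w - z‖ = s := mem_sphere_iff_norm.1 hw
    have h5 := h3 w (sphere_subset_closedBall hw)
    have h6 : ‖deriv f z * (w - z)‖ = A * s := by rw [norm_mul, hws]
    have h7 : deriv f z * (w - z) = (f w - f z) -
      ((f w - deriv f z * w) - (f z - deriv f z * z)) := by ring
    have h8 := norm_sub_le (f w - f z) ((f w - deriv f z * w) - (f z - deriv f z * z))
    rw [← h7, h6] at h8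
    rw [hws] at h5
    have : A * r / 32 = A * s - A / 2 * s := by rw [hs]; ring
    linarith
  have hdc : DiffContOnCl ℂ f (ball z s) := by
    apply DifferentiableOn.diffContOnCl
    rw [closure_ball _ (by positivity)]
    exact hf.mono hsub
  have h9 := hdc.ball_subset_image_closedBall (by positivity) h4 ?_
  · rw [show A * r / 64 = A * r / 32 / 2 by ring]
    exact h9.trans (Set.image_mono hsub)
  · have hder : HasDerivAt f (deriv f z) z := (hat z (mem_ball_self hr)).hasDerivAt
    exact ((hder.eventually_ne hz).frequently).filter_mono nhdsWithin_le_nhds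

open Metric in
/-- **Bloch's theorem** with a non-sharp constant, and without univalence: the image of a disc of
radius `R` contains a disc of radius comparable to `R * ‖deriv f z‖`. -/
theorem exists_ball_subset_image_ball {f : ℂ → ℂ} {z : ℂ} {R : ℝ} (hR : 0 < R)
    (hf : DifferentiableOn ℂ f (ball z R)) (hz : deriv f z ≠ 0) :
    ∃ c, ball c (R * ‖deriv f z‖ / 256) ⊆ f '' ball z R := by
  have hf' : ContinuousOn (deriv f) (ball z R) := (hf.deriv isOpen_ball).continuousOn
  have hsub : closedBall z (R / 2) ⊆ ball z R := closedBall_subset_ball (by linarith)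
  -- Maximize `(R / 2 - |w - z|) |f' w|`.
  obtain ⟨ζ, hζ, hmax⟩ := (isCompact_closedBall z (R / 2)).exists_isMaxOn
    ⟨z, mem_closedBall_self (by positivity)⟩
    (f := fun w => (R / 2 - ‖w - z‖) * ‖deriv f w‖)
    ((by fun_prop : Continuous fun w : ℂ => R / 2 - ‖w - z‖).continuousOn.mul
      (hf'.mono hsub).norm)
  have hmax' : ∀ w ∈ closedBall z (R / 2),
      (R / 2 - ‖w - z‖) * ‖deriv f w‖ ≤ (R / 2 - ‖ζ - z‖) * ‖deriv f ζ‖ := fun w hw => hmax hw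
  have hz0 := hmax' z (mem_closedBall_self (by positivity))
  simp only [sub_self, norm_zero, sub_zero] at hz0
  have hpos : 0 < R / 2 * ‖deriv f z‖ := mul_pos (by positivity) (norm_pos_iff.2 hz)
  have hζ' := mem_closedBall_iff_norm.1 hζ
  have hd0 : 0 < ‖deriv f ζ‖ := by
    by_contra h
    have : ‖deriv f ζ‖ = 0 := le_antisymm (not_lt.1 h) (norm_nonneg _)
    rw [this] at hz0; linarith
  have hρ0 : 0 < R / 2 - ‖ζ - z‖ := by
    by_contra h
    have : R / 2 - ‖ζ - z‖ = 0 := by linarith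
    rw [this] at hz0; linarith
  set ρ := (R / 2 - ‖ζ - z‖) / 2 with hρ
  have hρ1 : 0 < ρ := by positivity
  have hin : ball ζ ρ ⊆ closedBall z (R / 2) := by
    intro w hw
    rw [mem_closedBall_iff_norm]
    have := mem_ball_iff_norm.1 hw
    have h2 := norm_add_le (w - ζ) (ζ - z)
    rw [sub_add_sub_cancel] at h2
    linarith
  have := ball_subset_image_of_norm_deriv_le_two_mul hρ1 (hf.mono (hin.trans hsub))
    (norm_pos_iff.1 hd0) ?_
  · refine ⟨f ζ, ?_⟩
    refine (ball_subset_ball ?_).trans (this.trans (Set.image_mono (hin.trans hsub)))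
    have : ‖deriv f ζ‖ * ρ = (R / 2 - ‖ζ - z‖) * ‖deriv f ζ‖ / 2 := by rw [hρ]; ring
    rw [this]; linarith
  · intro w hw
    have h1 := hmax' w (hin hw)
    have h2 : ρ ≤ R / 2 - ‖w - z‖ := by
      have := mem_ball_iff_norm.1 hw
      have h2 := norm_add_le (w - ζ) (ζ - z)
      rw [sub_add_sub_cancel] at h2
      linarith
    have h3 : ρ * ‖deriv f w‖ ≤ ρ * (2 * ‖deriv f ζ‖) := by
      calc ρ * ‖deriv f w‖ ≤ (R / 2 - ‖w - z‖) * ‖deriv f w‖ := by gcongr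
        _ ≤ _ := h1
        _ = ρ * (2 * ‖deriv f ζ‖) := by rw [hρ]; ring
    exact le_of_mul_le_mul_left h3 hρ1

/-- Every point of the plane is within distance `4` of the set `cosh u ^ 2 ∈ ℤ`. -/
theorem exists_norm_sub_le_cosh_sq_eq_int (w : ℂ) :
    ∃ u : ℂ, ‖u - w‖ < 4 ∧ ∃ n : ℤ, Complex.cosh u ^ 2 = n := by
  wlog hw : 0 ≤ w.re generalizing w
  · obtain ⟨u, hu, n, hn⟩ := this (-w) (by simp; linarith)
    refine ⟨-u, ?_, n, by rw [Complex.cosh_neg, hn]⟩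
    rwa [← norm_neg, show -(-u - w) = u - -w by ring]
  set x := w.re
  have hs : Real.sinh x + 1 ≤ Real.sinh (x + 1) := by
    rw [Real.sinh_add]
    have h1 : 1 ≤ Real.cosh 1 := Real.one_le_cosh 1
    have h2 : 1 ≤ Real.cosh x := Real.one_le_cosh x
    have h3 : 1 ≤ Real.sinh 1 := Real.self_le_sinh_iff.2 zero_le_one
    have h4 : 0 ≤ Real.sinh x := Real.sinh_nonneg_iff.2 hw
    nlinarith [mul_nonneg h4 (sub_nonneg.2 h1),
      mul_nonneg (sub_nonneg.2 h2) (sub_nonneg.2 h3)]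
  have h0 : 0 ≤ Real.sinh x := Real.sinh_nonneg_iff.2 hw
  have hmem : (⌈Real.cosh x ^ 2⌉ : ℝ) ∈
      Set.Icc (Real.cosh x ^ 2) (Real.cosh (x + 1) ^ 2) := by
    refine ⟨Int.le_ceil _, ?_⟩
    have := (Int.ceil_lt_add_one (Real.cosh x ^ 2)).le
    rw [Real.cosh_sq] at this ⊢
    rw [Real.cosh_sq (x + 1)]
    nlinarith
  obtain ⟨t, ht, htn⟩ := intermediate_value_Icc (by linarith : x ≤ x + 1)
    (f := fun t => Real.cosh t ^ 2) (by fun_prop) hmem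
  set m : ℤ := round (w.im / Real.pi)
  have hm : |w.im - m * Real.pi| ≤ Real.pi / 2 := by
    have h1 := abs_sub_round (w.im / Real.pi)
    have h2 : w.im - m * Real.pi = (w.im / Real.pi - m) * Real.pi := by
      field_simp
    rw [h2, abs_mul, abs_of_pos Real.pi_pos]
    nlinarith [Real.pi_pos]
  refine ⟨(t : ℂ) + (m : ℂ) * (Real.pi * Complex.I), ?_, ⌈Real.cosh x ^ 2⌉, ?_⟩
  · refine (Complex.norm_le_abs_re_add_abs_im _).trans_lt ?_
    have h1 : |t - x| ≤ 1 := by rw [abs_le]; constructor <;> linarith [ht.1, ht.2]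
    have h2 : ((t : ℂ) + (m : ℂ) * (Real.pi * Complex.I) - w).re = t - x := by simp [x]
    have h3 : ((t : ℂ) + (m : ℂ) * (Real.pi * Complex.I) - w).im = m * Real.pi - w.im := by simp
    rw [h2, h3, abs_sub_comm _ w.im]
    linarith [Real.pi_lt_four]
  · have h1 : Complex.sinh ((m : ℂ) * (Real.pi * Complex.I)) = 0 := by
      rw [← mul_assoc, Complex.sinh_mul_I, Complex.sin_int_mul_pi, zero_mul]
    have h2 : Complex.cosh ((m : ℂ) * (Real.pi * Complex.I)) ^ 2 = 1 := by
      rw [Complex.cosh_sq, h1]; simp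
    rw [Complex.cosh_add, h1, mul_zero, add_zero, mul_pow, h2, mul_one, ← Complex.ofReal_cosh]
    exact_mod_cast htn

/-! ### The theorems of Picard and Montel -/

/-- On a domain where every holomorphic function has a primitive, every zero-free holomorphic
function has a holomorphic logarithm. -/
theorem exists_eq_exp_of_forall_isExactOn {U : Set ℂ} (hU : IsOpen U) (hc : IsPreconnected U)
    (hex : ∀ F : ℂ → ℂ, DifferentiableOn ℂ F U → Complex.IsExactOn F U) {f : ℂ → ℂ}
    (hf : DifferentiableOn ℂ f U) (h0 : ∀ z ∈ U, f z ≠ 0) :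
    ∃ u : ℂ → ℂ, DifferentiableOn ℂ u U ∧ ∀ z ∈ U, f z = Complex.exp (u z) := by
  rcases U.eq_empty_or_nonempty with rfl | ⟨z₀, hz₀⟩
  · exact ⟨f, hf, by simp⟩
  obtain ⟨u, hu0, hu⟩ := (hex (fun z => deriv f z / f z) ((hf.deriv hU).div hf h0)).with_val_at z₀
    (Complex.log (f z₀))
  have hud : DifferentiableOn ℂ u U := fun z hz => (hu z hz).differentiableAt.differentiableWithinAt
  refine ⟨u, hud, ?_⟩
  have hq : ∀ z ∈ U, HasDerivAt (fun z => f z * Complex.exp (-u z)) 0 z := by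
    intro z hz
    have h1 : HasDerivAt (fun z => f z * Complex.exp (-u z)) (deriv f z * Complex.exp (-u z) +
        f z * (Complex.exp (-u z) * -(deriv f z / f z))) z :=
      ((hf.differentiableAt (hU.mem_nhds hz)).hasDerivAt).mul ((hu z hz).neg.cexp)
    have h2 : deriv f z * Complex.exp (-u z) +
        f z * (Complex.exp (-u z) * -(deriv f z / f z)) = 0 := by
      have := h0 z hz
      field_simp
      ring
    rwa [h2] at h1
  intro z hz
  have h2 : f z * Complex.exp (-u z) = f z₀ * Complex.exp (-u z₀) :=
    hU.is_const_of_deriv_eq_zero hc (fun z hz => (hq z hz).differentiableAt.differentiableWithinAt)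
      (fun z hz => (hq z hz).deriv) hz hz₀
  rw [hu0, Complex.exp_neg, Complex.exp_neg, Complex.exp_log (h0 z₀ hz₀),
    mul_inv_cancel₀ (h0 z₀ hz₀)] at h2
  exact (mul_inv_eq_one₀ (Complex.exp_ne_zero _)).1 h2

theorem exists_eq_sq_of_forall_isExactOn {U : Set ℂ} (hU : IsOpen U) (hc : IsPreconnected U)
    (hex : ∀ F : ℂ → ℂ, DifferentiableOn ℂ F U → Complex.IsExactOn F U) {f : ℂ → ℂ}
    (hf : DifferentiableOn ℂ f U) (h0 : ∀ z ∈ U, f z ≠ 0) :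
    ∃ s : ℂ → ℂ, DifferentiableOn ℂ s U ∧ ∀ z ∈ U, f z = s z ^ 2 := by
  obtain ⟨u, hu, h⟩ := exists_eq_exp_of_forall_isExactOn hU hc hex hf h0
  refine ⟨fun z => Complex.exp (u z / 2), (hu.div_const 2).cexp, fun z hz => ?_⟩
  rw [h z hz, ← Complex.exp_nat_mul]
  congr 1
  push_cast
  ring

/-- A holomorphic function omitting `0` and `1` is `cosh u ^ 2` for a holomorphic `u`. -/
theorem exists_eq_cosh_sq_of_forall_isExactOn {U : Set ℂ} (hU : IsOpen U) (hc : IsPreconnected U)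
    (hex : ∀ F : ℂ → ℂ, DifferentiableOn ℂ F U → Complex.IsExactOn F U) {f : ℂ → ℂ}
    (hf : DifferentiableOn ℂ f U) (h0 : ∀ z ∈ U, f z ≠ 0) (h1 : ∀ z ∈ U, f z ≠ 1) :
    ∃ u : ℂ → ℂ, DifferentiableOn ℂ u U ∧ ∀ z ∈ U, f z = Complex.cosh (u z) ^ 2 := by
  obtain ⟨s, hs, hsf⟩ := exists_eq_sq_of_forall_isExactOn hU hc hex hf h0
  obtain ⟨t, ht, htf⟩ := exists_eq_sq_of_forall_isExactOn hU hc hex (f := fun z => f z - 1)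
    (hf.sub_const 1) (fun z hz => sub_ne_zero.2 (h1 z hz))
  have hst : ∀ z ∈ U, (s z + t z) * (s z - t z) = 1 := by
    intro z hz
    have h2 := hsf z hz
    have h3 := htf z hz
    linear_combination h3 - h2
  obtain ⟨u, hu, hue⟩ := exists_eq_exp_of_forall_isExactOn hU hc hex (f := fun z => s z + t z)
    (hs.add ht) (fun z hz => left_ne_zero_of_mul_eq_one (hst z hz))
  refine ⟨u, hu, fun z hz => ?_⟩
  have h2 : s z - t z = Complex.exp (-u z) := by
    rw [Complex.exp_neg, ← hue z hz]
    exact eq_inv_of_mul_eq_one_right (hst z hz)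
  have h3 : Complex.cosh (u z) = s z := by
    rw [Complex.cosh, ← hue z hz, ← h2]; ring
  rw [h3, hsf z hz]

open Metric in
/-- If `cosh u ^ 2` omits the integers, Bloch's theorem bounds the derivative of `u`. -/
theorem norm_deriv_le_of_cosh_sq_ne_int {u : ℂ → ℂ} {z : ℂ} {R : ℝ} (hR : 0 < R)
    (hu : DifferentiableOn ℂ u (ball z R))
    (hn : ∀ w ∈ ball z R, ∀ n : ℤ, Complex.cosh (u w) ^ 2 ≠ n) :
    ‖deriv u z‖ ≤ 1024 / R := by
  by_contra hlt
  rw [not_le, div_lt_iff₀ hR] at hlt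
  have h0 : deriv u z ≠ 0 := by
    intro h
    rw [h] at hlt; norm_num at hlt
  obtain ⟨c, hc⟩ := exists_ball_subset_image_ball hR hu h0
  obtain ⟨v, hv, n, hvn⟩ := exists_norm_sub_le_cosh_sq_eq_int c
  have hvb : v ∈ ball c (R * ‖deriv u z‖ / 256) := by
    rw [mem_ball_iff_norm]; linarith
  obtain ⟨w, hw, rfl⟩ := hc hvb
  exact hn w hw n hvn

/-- **Little Picard theorem**: an entire function omitting two values is constant. -/
theorem exists_const_of_forall_ne_of_forall_ne {f : ℂ → ℂ} (hf : Differentiable ℂ f) {p q : ℂ}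
    (hpq : p ≠ q) (hp : ∀ z, f z ≠ p) (hq : ∀ z, f z ≠ q) : ∃ c, ∀ z, f z = c := by
  have hex : ∀ F : ℂ → ℂ, DifferentiableOn ℂ F Set.univ → Complex.IsExactOn F Set.univ :=
    fun F hF => (differentiableOn_univ.1 hF).isExactOn_univ
  have hqp : q - p ≠ 0 := sub_ne_zero.2 hpq.symm
  obtain ⟨A, hA, hfA⟩ := exists_eq_exp_of_forall_isExactOn isOpen_univ isPreconnected_univ hex
    (f := fun z => (f z - p) / (q - p)) (by fun_prop)
    (fun z _ => div_ne_zero (sub_ne_zero.2 (hp z)) hqp)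
  have hAint : ∀ z, ∀ n : ℤ, A z / (2 * Real.pi * Complex.I) ≠ n := by
    intro z n hn
    have h1 : Complex.exp (A z) = 1 := by
      rw [Complex.exp_eq_one_iff]
      refine ⟨n, ?_⟩
      rw [← hn]
      field_simp
    rw [← hfA z trivial, div_eq_one_iff_eq hqp] at h1
    exact hq z (sub_left_injective h1)
  obtain ⟨u, hu, hAu⟩ := exists_eq_cosh_sq_of_forall_isExactOn isOpen_univ isPreconnected_univ hex
    (f := fun z => A z / (2 * Real.pi * Complex.I)) (hA.div_const _)
    (fun z _ => by simpa using hAint z 0) (fun z _ => by simpa using hAint z 1)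
  have hu' : ∀ z, deriv u z = 0 := by
    intro z
    rw [← norm_le_zero_iff]
    have h1 : ∀ R > 0, ‖deriv u z‖ ≤ 1024 / R := fun R hR =>
      norm_deriv_le_of_cosh_sq_ne_int hR (hu.mono (Set.subset_univ _))
        (fun w _ n => by rw [← hAu w trivial]; exact hAint w n)
    have h2 : Tendsto (fun R : ℝ => 1024 / R) atTop (𝓝 0) := tendsto_const_nhds.div_atTop tendsto_id
    refine ge_of_tendsto h2 ?_
    filter_upwards [eventually_gt_atTop 0] with R hR using h1 R hR
  have hconst := is_const_of_deriv_eq_zero (differentiableOn_univ.1 hu) hu'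
  refine ⟨f 0, fun z => ?_⟩
  have h3 : A z = A 0 := by
    have h4 := hAu z trivial
    have h5 := hAu 0 trivial
    rw [hconst z 0, ← h5] at h4
    have : (2 * Real.pi * Complex.I : ℂ) ≠ 0 := Complex.two_pi_I_ne_zero
    exact (div_left_inj' this).1 h4
  have h4 := hfA z trivial
  have h5 := hfA 0 trivial
  rw [h3, ← h5] at h4
  exact sub_left_injective ((div_left_inj' hqp).1 h4)

open Metric Classical in
/-- **Montel's theorem** for a uniformly bounded sequence on a disc. -/
theorem exists_subseq_tendstoUniformlyOn_of_norm_le {φ : ℕ → ℂ → ℂ} {z : ℂ} {R M : ℝ} (hR : 0 < R)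
    (hφ : ∀ n, DifferentiableOn ℂ (φ n) (ball z R)) (hM : ∀ n, ∀ w ∈ ball z R, ‖φ n w‖ ≤ M) :
    ∃ k : ℕ → ℕ, StrictMono k ∧ ∃ η : ℂ → ℂ,
      TendstoUniformlyOn (fun n => φ (k n)) η atTop (closedBall z (R / 2)) := by
  set K := closedBall z (R / 2) with hK
  have hKR : K ⊆ ball z R := closedBall_subset_ball (by linarith)
  have : CompactSpace K := isCompact_iff_compactSpace.1 (isCompact_closedBall z (R / 2))
  let Φ : ℕ → BoundedContinuousFunction K ℂ := fun n => BoundedContinuousFunction.mkOfCompact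
    ⟨K.domRestrict (φ n), continuousOn_iff_continuous_domRestrict.1 ((hφ n).continuousOn.mono hKR)⟩
  have hΦ : ∀ n (x : K), Φ n x = φ n x := fun n x => rfl
  have hcomp : IsCompact (closure (Set.range Φ)) := by
    apply BoundedContinuousFunction.arzela_ascoli (closedBall (0 : ℂ) M) (isCompact_closedBall _ _)
    · rintro _ x ⟨n, rfl⟩
      rw [mem_closedBall_zero_iff, hΦ]
      exact hM n x (hKR x.2)
    · apply Metric.equicontinuous_of_continuity_modulus (fun d => M / (R / 4) * d)
      · have : Continuous fun d : ℝ => M / (R / 4) * d := by fun_prop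
        simpa using this.tendsto 0
      · rintro x y ⟨_, n, rfl⟩
        have := norm_sub_le_of_norm_le_on_ball hR (hφ n) (hM n) y.2 x.2
        simpa only [dist_eq_norm, hΦ, Subtype.dist_eq] using this
  obtain ⟨F, -, k, hk, hF⟩ := hcomp.tendsto_subseq (fun n => subset_closure (Set.mem_range_self n))
  refine ⟨k, hk, fun w => if h : w ∈ K then F ⟨w, h⟩ else 0, ?_⟩
  rw [BoundedContinuousFunction.tendsto_iff_tendstoUniformly, Metric.tendstoUniformly_iff] at hF
  rw [Metric.tendstoUniformlyOn_iff]
  intro ε hε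
  filter_upwards [hF ε hε] with n hn w hw
  have := hn ⟨w, hw⟩
  simpa [hw, hΦ] using this

/-- The symmetries `w ↦ -w` and `w ↦ w + π i` of `cosh w ^ 2` move any point into a fixed half
strip. -/
theorem exists_cosh_sq_eq_im_le (v : ℂ) : ∃ v' : ℂ, 0 ≤ v'.re ∧ |v'.im| ≤ 4 ∧
    ((∃ e : ℂ, ∀ w, Complex.cosh (w + e) ^ 2 = Complex.cosh w ^ 2 ∧ v' = v + e) ∨
    (∃ e : ℂ, ∀ w, Complex.cosh (-w + e) ^ 2 = Complex.cosh w ^ 2 ∧ v' = -v + e)) := by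
  have key : ∀ v : ℂ, ∃ e : ℂ, e.re = 0 ∧ |(v + e).im| ≤ 4 ∧
      ∀ w, Complex.cosh (w + e) ^ 2 = Complex.cosh w ^ 2 := by
    intro v
    set m : ℤ := round (v.im / Real.pi)
    refine ⟨-((m : ℂ) * (Real.pi * Complex.I)), by simp, ?_, fun w => ?_⟩
    · have h1 := abs_sub_round (v.im / Real.pi)
      have h2 : (v + -((m : ℂ) * (Real.pi * Complex.I))).im = (v.im / Real.pi - m) * Real.pi := by
        simp
        field_simp
        ring
      rw [h2, abs_mul, abs_of_pos Real.pi_pos]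
      nlinarith [Real.pi_pos, Real.pi_lt_four]
    · have h1 : Complex.sinh ((m : ℂ) * (Real.pi * Complex.I)) = 0 := by
        rw [← mul_assoc, Complex.sinh_mul_I, Complex.sin_int_mul_pi, zero_mul]
      have h2 : Complex.cosh ((m : ℂ) * (Real.pi * Complex.I)) ^ 2 = 1 := by
        rw [Complex.cosh_sq, h1]; simp
      rw [← sub_eq_add_neg, Complex.cosh_sub, h1, mul_zero, sub_zero, mul_pow, h2, mul_one]
  rcases le_total 0 v.re with h | h
  · obtain ⟨e, he, him, hcosh⟩ := key v
    exact ⟨v + e, by simp [he, h], him, Or.inl ⟨e, fun w => ⟨hcosh w, rfl⟩⟩⟩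
  · obtain ⟨e, he, him, hcosh⟩ := key (-v)
    refine ⟨-v + e, by simp [he, h], him, Or.inr ⟨e, fun w => ⟨?_, rfl⟩⟩⟩
    rw [hcosh, Complex.cosh_neg]

open Metric in
/-- A holomorphic function on a disc omitting the integers is `cosh u ^ 2` where `u` has bounded
oscillation on the smaller disc and, at the centre, lies in a fixed half strip. -/
theorem exists_eq_cosh_sq_of_ne_int {f : ℂ → ℂ} {z : ℂ} {R : ℝ} (hR : 0 < R)
    (hf : DifferentiableOn ℂ f (ball z R)) (hn : ∀ w ∈ ball z R, ∀ n : ℤ, f w ≠ n) :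
    ∃ u : ℂ → ℂ, (∀ w ∈ ball z R, f w = Complex.cosh (u w) ^ 2) ∧ 0 ≤ (u z).re ∧
      |(u z).im| ≤ 4 ∧ ∀ w ∈ ball z (R / 2), ‖u w - u z‖ ≤ 1024 := by
  obtain ⟨u, hu, hfu⟩ := exists_eq_cosh_sq_of_forall_isExactOn isOpen_ball
    (convex_ball z R).isPreconnected (fun F hF => hF.isExactOn_ball) hf
    (fun w hw => by simpa using hn w hw 0) (fun w hw => by simpa using hn w hw 1)
  have hlip : ∀ w ∈ ball z (R / 2), ‖u w - u z‖ ≤ 1024 := by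
    intro w hw
    have h1 := (convex_ball z (R / 2)).norm_image_sub_le_of_norm_deriv_le (f := u)
      (C := 1024 / (R / 2)) ?_ ?_ (mem_ball_self (by positivity)) hw
    · refine h1.trans ?_
      have h2 := (mem_ball_iff_norm.1 hw).le
      calc 1024 / (R / 2) * ‖w - z‖ ≤ 1024 / (R / 2) * (R / 2) := by gcongr
        _ = 1024 := by field_simp
    · intro x hx
      exact hu.differentiableAt (isOpen_ball.mem_nhds (ball_subset_ball (by linarith) hx))
    · intro x hx
      have hsub : ball x (R / 2) ⊆ ball z R := by
        apply ball_subset_ball'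
        have := mem_ball.1 hx
        linarith
      exact norm_deriv_le_of_cosh_sq_ne_int (by positivity) (hu.mono hsub)
        (fun y hy n => by rw [← hfu y (hsub hy)]; exact hn y (hsub hy) n)
  obtain ⟨v', hre, him, ⟨e, he⟩ | ⟨e, he⟩⟩ := exists_cosh_sq_eq_im_le (u z)
  · refine ⟨fun w => u w + e, fun w hw => ?_, ?_, ?_, fun w hw => ?_⟩
    · rw [hfu w hw, (he (u w)).1]
    · simpa only [← (he 0).2] using hre
    · simpa only [← (he 0).2] using him
    · simpa using hlip w hw
  · refine ⟨fun w => -u w + e, fun w hw => ?_, ?_, ?_, fun w hw => ?_⟩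
    · rw [hfu w hw, (he (u w)).1]
    · simpa only [← (he 0).2] using hre
    · simpa only [← (he 0).2] using him
    · have := hlip w hw
      rw [← norm_neg]
      simpa [add_comm, sub_eq_add_neg] using this

theorem sinh_abs_re_le_norm_cosh (v : ℂ) : Real.sinh |v.re| ≤ ‖Complex.cosh v‖ := by
  have h1 : Real.sinh |v.re| = |‖Complex.exp v‖ - ‖Complex.exp (-v)‖| / 2 := by
    rw [Complex.norm_exp, Complex.norm_exp, Complex.neg_re, ← Real.abs_sinh, Real.sinh_eq, abs_div,
      abs_two]
  have h2 : ‖Complex.cosh v‖ = ‖Complex.exp v + Complex.exp (-v)‖ / 2 := by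
    rw [Complex.cosh, norm_div]; simp
  rw [h1, h2]
  have h3 := abs_norm_sub_norm_le (Complex.exp v) (-Complex.exp (-v))
  rw [norm_neg, sub_neg_eq_add] at h3
  linarith

theorem norm_cosh_le_exp (v : ℂ) : ‖Complex.cosh v‖ ≤ Real.exp ‖v‖ := by
  rw [Complex.cosh, norm_div]
  have h1 := norm_add_le (Complex.exp v) (Complex.exp (-v))
  have h2 := Complex.norm_exp_le_exp_norm v
  have h3 := Complex.norm_exp_le_exp_norm (-v)
  rw [norm_neg] at h3
  simp only [Complex.norm_ofNat]
  linarith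

open Metric in
/-- **Montel's theorem** for holomorphic functions omitting the integers. -/
theorem exists_subseq_of_ne_int {φ : ℕ → ℂ → ℂ} {z : ℂ} {R : ℝ} (hR : 0 < R)
    (hφ : ∀ n, DifferentiableOn ℂ (φ n) (ball z R))
    (hint : ∀ n, ∀ w ∈ ball z R, ∀ m : ℤ, φ n w ≠ m) :
    ∃ k : ℕ → ℕ, StrictMono k ∧
      ((∃ η : ℂ → ℂ, TendstoLocallyUniformlyOn (fun n => φ (k n)) η atTop (ball z (R / 4))) ∨
        TendstoInftyLocallyUniformlyOn (fun n => φ (k n)) (ball z (R / 4))) := by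
  choose u hu hre him hlip using fun n => exists_eq_cosh_sq_of_ne_int hR (hφ n) (hint n)
  by_cases hbd : ∃ B, ∀ n, (u n z).re ≤ B
  · obtain ⟨B, hB⟩ := hbd
    have hb : ∀ n, ∀ w ∈ ball z (R / 2), ‖φ n w‖ ≤ Real.exp (B + 4 + 1024) ^ 2 := by
      intro n w hw
      rw [hu n w (ball_subset_ball (by linarith) hw), norm_pow]
      gcongr
      refine (norm_cosh_le_exp _).trans (Real.exp_le_exp.2 ?_)
      have h1 := hlip n w hw
      have h2 := Complex.norm_le_abs_re_add_abs_im (u n z)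
      rw [abs_of_nonneg (hre n)] at h2
      have h3 := norm_sub_norm_le (u n w) (u n z)
      linarith [hB n, him n]
    obtain ⟨k, hk, η, hη⟩ := exists_subseq_tendstoUniformlyOn_of_norm_le (by positivity)
      (fun n => (hφ n).mono (ball_subset_ball (by linarith))) hb
    refine ⟨k, hk, Or.inl ⟨η, TendstoUniformlyOn.tendstoLocallyUniformlyOn (hη.mono ?_)⟩⟩
    refine ball_subset_closedBall.trans (closedBall_subset_closedBall ?_)
    linarith
  · push Not at hbd
    obtain ⟨k, hk, hkt⟩ : ∃ k : ℕ → ℕ, StrictMono k ∧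
        Tendsto (fun n => (u (k n) z).re) atTop atTop := by
      have hfreq : ∀ B : ℝ, ∃ᶠ n in atTop, B ≤ (u n z).re := by
        intro B
        rw [frequently_atTop]
        intro N
        obtain ⟨C, hC⟩ := ((Set.finite_Iio N).image (fun n => (u n z).re)).bddAbove
        obtain ⟨n, hn⟩ := hbd (max B C)
        refine ⟨n, ?_, (le_max_left _ _).trans hn.le⟩
        by_contra hlt
        have := hC ⟨n, not_le.1 hlt, rfl⟩
        exact absurd (this.trans (le_max_right B C)) (not_le.2 hn)
      obtain ⟨k, hk, hkB⟩ := extraction_forall_of_frequently (fun n : ℕ => hfreq n)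
      exact ⟨k, hk, tendsto_atTop_mono hkB tendsto_natCast_atTop_atTop⟩
    refine ⟨k, hk, Or.inr ?_⟩
    intro K hK _ M
    filter_upwards [hkt.eventually_ge_atTop (1024 + max M 1)] with n hn w hw
    have hw' := hK hw
    rw [hu (k n) w (ball_subset_ball (by linarith) hw'), norm_pow]
    have h1 := hlip (k n) w (ball_subset_ball (by linarith) hw')
    have h2 := (Complex.abs_re_le_norm _).trans h1
    rw [Complex.sub_re, abs_le] at h2
    have h3 : max M 1 ≤ |(u (k n) w).re| := by
      refine le_trans ?_ (le_abs_self _)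
      linarith [h2.1]
    have h4 : max M 1 ≤ ‖Complex.cosh (u (k n) w)‖ :=
      h3.trans ((Real.self_le_sinh_iff.2 (abs_nonneg _)).trans (sinh_abs_re_le_norm_cosh _))
    have h5 : 1 ≤ ‖Complex.cosh (u (k n) w)‖ := (le_max_right _ _).trans h4
    nlinarith [le_max_left M 1]

/-! ### Injective entire functions and normal families -/

theorem exists_affine_of_deriv_eq {f : ℂ → ℂ} (hf : Differentiable ℂ f) {c : ℂ}
    (h : ∀ z, deriv f z = c) : ∃ α β : ℂ, ∀ z, f z = α * z + β := by
  refine ⟨c, f 0, fun z => ?_⟩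
  have h1 : ∀ z, HasDerivAt (fun z => f z - c * z) 0 z := by
    intro z
    have h2 : HasDerivAt (fun z => f z - c * z) (deriv f z - c * 1) z :=
      (hf z).hasDerivAt.sub ((hasDerivAt_id z).const_mul c)
    rwa [h, mul_one, sub_self] at h2
  have h2 : f z - c * z = f 0 - c * 0 :=
    is_const_of_deriv_eq_zero (fun z => (h1 z).differentiableAt) (fun z => (h1 z).deriv) z 0
  linear_combination h2

theorem isOpenMap_of_not_const {f : ℂ → ℂ} (hf : Differentiable ℂ f)
    (h : ¬ ∃ c, ∀ z, f z = c) : IsOpenMap f :=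
  (AnalyticOnNhd.is_constant_or_isOpenMap
    (fun z _ => hf.analyticAt z)).resolve_left h

open Metric in
/-- An injective entire function is affine: if `f' x ≠ 0`, then `z ↦ (z - x) / (f z - f x)` is a
zero-free entire function of at most linear growth, hence constant. -/
theorem exists_affine_of_injective {f : ℂ → ℂ} (hf : Differentiable ℂ f)
    (hi : Function.Injective f) : ∃ α β : ℂ, ∀ z, f z = α * z + β := by
  have hnc : ¬ ∃ c, ∀ z, f z = c := by
    rintro ⟨c, hc⟩
    exact zero_ne_one (hi ((hc 0).trans (hc 1).symm))
  obtain ⟨x, hx⟩ : ∃ x, deriv f x ≠ 0 := by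
    by_contra! h
    exact hnc ⟨f 0, fun z => is_const_of_deriv_eq_zero hf h z 0⟩
  have hdsl : ∀ g : ℂ → ℂ, Differentiable ℂ g → Differentiable ℂ (dslope g x) := by
    intro g hg
    rw [← differentiableOn_univ, Complex.differentiableOn_dslope univ_mem]
    exact hg.differentiableOn
  have hd0 : ∀ z, dslope f x z ≠ 0 := by
    intro z
    rcases eq_or_ne z x with rfl | hz
    · rwa [dslope_same]
    · rw [dslope_of_ne _ hz, slope_def_field]
      exact div_ne_zero (sub_ne_zero.2 (hi.ne hz)) (sub_ne_zero.2 hz)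
  set P : ℂ → ℂ := fun z => (dslope f x z)⁻¹ with hP
  have hPd : Differentiable ℂ P := (hdsl f hf).inv hd0
  have hP0 : ∀ z, P z ≠ 0 := fun z => inv_ne_zero (hd0 z)
  obtain ⟨r, hr, hball⟩ : ∃ r > 0, ball (f x) r ⊆ f '' ball x 1 :=
    Metric.isOpen_iff.1 (isOpenMap_of_not_const hf hnc _ isOpen_ball) _
      ⟨x, mem_ball_self one_pos, rfl⟩
  have hfar : ∀ z, 1 ≤ ‖z - x‖ → r ≤ ‖f z - f x‖ := by
    intro z hz
    by_contra hlt
    obtain ⟨w, hw, hwz⟩ := hball (mem_ball_iff_norm.2 (not_le.1 hlt))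
    rw [hi hwz, mem_ball_iff_norm] at hw
    linarith
  have hPfar : ∀ z, 1 ≤ ‖z - x‖ → ‖P z‖ ≤ ‖z - x‖ / r := by
    intro z hz
    have hzx : z ≠ x := by
      rintro rfl
      norm_num at hz
    rw [hP]
    simp only
    rw [dslope_of_ne _ hzx, slope_def_field, inv_div, norm_div]
    have := hfar z hz
    gcongr
  obtain ⟨C, hC⟩ := ((isCompact_closedBall x 1).image (hdsl P hPd).continuous).isBounded.exists_norm_le
  have hQ : Bornology.IsBounded (Set.range (dslope P x)) := by
    rw [isBounded_iff_forall_norm_le]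
    refine ⟨max C (1 / r + ‖P x‖), ?_⟩
    rintro _ ⟨z, rfl⟩
    rcases le_total ‖z - x‖ 1 with hz | hz
    · exact (hC _ ⟨z, mem_closedBall_iff_norm.2 hz, rfl⟩).trans (le_max_left _ _)
    · have hzx : z ≠ x := by
        rintro rfl
        norm_num at hz
      refine le_trans ?_ (le_max_right _ _)
      rw [dslope_of_ne _ hzx, slope_def_field, norm_div, div_le_iff₀ (by linarith)]
      calc ‖P z - P x‖ ≤ ‖P z‖ + ‖P x‖ := norm_sub_le _ _
        _ ≤ ‖z - x‖ / r + ‖P x‖ * ‖z - x‖ :=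
            add_le_add (hPfar z hz) (le_mul_of_one_le_right (norm_nonneg _) hz)
        _ = (1 / r + ‖P x‖) * ‖z - x‖ := by ring
  obtain ⟨κ, hκ⟩ := (hdsl P hPd).exists_const_forall_eq_of_bounded hQ
  have hPeq : ∀ z, P z = P x + (z - x) * κ := by
    intro z
    have h1 := sub_smul_dslope P x z
    rw [hκ, smul_eq_mul] at h1
    rw [h1]; ring
  have hκ0 : κ = 0 := by
    by_contra hne
    refine hP0 (x - P x / κ) ?_
    rw [hPeq]
    field_simp
    ring
  refine ⟨dslope f x x, f x - dslope f x x * x, fun z => ?_⟩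
  have h1 := sub_smul_dslope f x z
  have h2 : dslope f x z = dslope f x x := by
    have := hPeq z
    rw [hκ0, mul_zero, add_zero] at this
    exact inv_injective this
  rw [h2, smul_eq_mul] at h1
  linear_combination -h1

theorem IsNormalOn.mono {𝓕 𝓖 : Set (ℂ → ℂ)} {U V : Set ℂ} (h : IsNormalOn 𝓕 U) (hV : V ⊆ U)
    (hG : 𝓖 ⊆ 𝓕) : IsNormalOn 𝓖 V := by
  intro u hu
  obtain ⟨k, hk, ⟨η, hη⟩ | hinf⟩ := h u (fun n => hG (hu n))
  · exact ⟨k, hk, Or.inl ⟨η, hη.mono hV⟩⟩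
  · exact ⟨k, hk, Or.inr fun K hK => hinf K (hK.trans hV)⟩

/-- Normality is preserved under composition on the left with affine isometries whose translation
parts are bounded. -/
theorem IsNormalOn.of_affine {𝓕 𝓖 : Set (ℂ → ℂ)} {U : Set ℂ} (B : ℝ) (h : IsNormalOn 𝓕 U)
    (hc : ∀ f ∈ 𝓕, Continuous f) (hG : ∀ g ∈ 𝓖, ∃ f ∈ 𝓕, ∃ α β : ℂ, ‖α‖ = 1 ∧ ‖β‖ ≤ B ∧ ∀ z, g z = α * f z + β) :
    IsNormalOn 𝓖 U := by
  intro u hu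
  choose v hv α β hα hβ huv using fun n => hG (u n) (hu n)
  obtain ⟨k, hk, hkv⟩ := h v hv
  obtain ⟨p, -, l, hl, hp⟩ := ((isCompact_sphere (0 : ℂ) 1).prod
    (isCompact_closedBall (0 : ℂ) B)).tendsto_subseq (x := fun n => (α (k n), β (k n)))
    (fun n => ⟨by simp [hα], by simp [hβ]⟩)
  refine ⟨k ∘ l, hk.comp hl, ?_⟩
  rcases hkv with ⟨η, hη⟩ | hinf
  · refine Or.inl ⟨fun z => p.1 * η z + p.2, ?_⟩
    have hηc : ContinuousOn η U :=
      hη.continuousOn (Eventually.of_forall fun n => (hc _ (hv _)).continuousOn).frequently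
    rw [Metric.tendstoLocallyUniformlyOn_iff] at hη ⊢
    intro ε hε z hz
    obtain ⟨t, ht, hev⟩ := hη (ε / 3) (by positivity) z hz
    have hα1 : Tendsto (fun n => α (k (l n))) atTop (𝓝 p.1) := (continuous_fst.tendsto _).comp hp
    have hβ1 : Tendsto (fun n => β (k (l n))) atTop (𝓝 p.2) := (continuous_snd.tendsto _).comp hp
    have hM : 0 < ‖η z‖ + 1 := by positivity
    have hbd : ∀ᶠ y in 𝓝[U] z, ‖η y‖ < ‖η z‖ + 1 :=
      (hηc z hz).norm.eventually (gt_mem_nhds (by linarith))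
    refine ⟨t ∩ {y | ‖η y‖ < ‖η z‖ + 1}, inter_mem ht hbd, ?_⟩
    filter_upwards [hl.tendsto_atTop.eventually hev,
      Metric.tendsto_nhds.1 hα1 (ε / 3 / (‖η z‖ + 1)) (by positivity),
      Metric.tendsto_nhds.1 hβ1 (ε / 3) (by positivity)] with n h1 h2 h3 y hy
    have h4 := h1 y hy.1
    simp only [Function.comp_apply]
    rw [dist_comm, dist_eq_norm] at h4 ⊢
    rw [dist_eq_norm] at h2 h3
    rw [huv]
    set a := α (k (l n)) with ha
    set b := β (k (l n)) with hb
    set w := v (k (l n)) y with hw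
    have h5 : a * w + b - (p.1 * η y + p.2) = a * (w - η y) + (a - p.1) * η y + (b - p.2) := by
      ring
    rw [h5]
    refine (norm_add₃_le).trans_lt ?_
    rw [norm_mul, norm_mul, ha, hα, one_mul, ← ha]
    have h6 : ‖a - p.1‖ * ‖η y‖ ≤ ε / 3 := by
      calc ‖a - p.1‖ * ‖η y‖ ≤ ε / 3 / (‖η z‖ + 1) * (‖η z‖ + 1) :=
            mul_le_mul h2.le (le_of_lt hy.2) (norm_nonneg _) (by positivity)
        _ = ε / 3 := by field_simp
    linarith
  · right
    intro K hK hKc M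
    filter_upwards [hl.tendsto_atTop.eventually (hinf K hK hKc (M + B))] with n hn z hz
    have h1 := hn z hz
    simp only [Function.comp_apply]
    rw [huv]
    have h2 : ‖α (k (l n)) * v (k (l n)) z‖ = ‖v (k (l n)) z‖ := by rw [norm_mul, hα, one_mul]
    have h3 := norm_sub_le (α (k (l n)) * v (k (l n)) z + β (k (l n))) (β (k (l n)))
    rw [add_sub_cancel_right, h2] at h3
    linarith [hβ (k (l n))]

/-- Normality descends along `s`: if the compositions of a family with `s` are normal on `U`, the
family is normal on the image of a compact part of `U`. -/
theorem IsNormalOn.of_comp {𝓕 : Set (ℂ → ℂ)} {s : ℂ → ℂ} {U K V : Set ℂ}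
    (h : IsNormalOn {g | ∃ f ∈ 𝓕, g = f ∘ s} U) (hK : IsCompact K) (hKU : K ⊆ U)
    (hV : V ⊆ s '' K) : IsNormalOn 𝓕 V := by
  intro u hu
  have hV' : ∀ y ∈ V, ∃ x ∈ K, s x = y := hV
  choose! σ hσK hσ using hV'
  obtain ⟨k, hk, ⟨η, hη⟩ | hinf⟩ := h (fun n => u n ∘ s) (fun n => ⟨u n, hu n, rfl⟩)
  · refine ⟨k, hk, Or.inl ⟨η ∘ σ, TendstoUniformlyOn.tendstoLocallyUniformlyOn ?_⟩⟩
    have h1 := (tendstoLocallyUniformlyOn_iff_tendstoUniformlyOn_of_compact hK).1 (hη.mono hKU)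
    rw [Metric.tendstoUniformlyOn_iff] at h1 ⊢
    intro ε hε
    filter_upwards [h1 ε hε] with n hn y hy
    have := hn (σ y) (hσK _ hy)
    rwa [Function.comp_apply, hσ _ hy] at this
  · refine ⟨k, hk, Or.inr fun L hL _ M => ?_⟩
    filter_upwards [hinf K hKU hK M] with n hn y hy
    have := hn (σ y) (hσK _ (hL hy))
    rwa [Function.comp_apply, hσ _ (hL hy)] at this

theorem fatouSetOf_subset_of_affine {f g : ℂ → ℂ} (B : ℝ) (hf : Continuous f)
    (h : ∀ n, 1 ≤ n → ∃ α β : ℂ, ‖α‖ = 1 ∧ ‖β‖ ≤ B ∧ ∀ z, g^[n] z = α * f^[n] z + β) :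
    fatouSetOf f ⊆ fatouSetOf g := by
  rintro z ⟨r, hr, hn⟩
  refine ⟨r, hr, hn.of_affine B ?_ ?_⟩
  · rintro _ ⟨n, -, rfl⟩
    exact hf.iterate n
  rintro _ ⟨n, hn1, rfl⟩
  obtain ⟨α, β, hα, hβ, hz⟩ := h n hn1
  exact ⟨_, ⟨n, hn1, rfl⟩, α, β, hα, hβ, hz⟩

open Metric in
/-- The Fatou set of `f` is mapped into itself by every open map `s` for which each `f^[n] ∘ s` is an
iterate of `f` up to a bounded affine isometry; for instance by `f`, and by translations along
pseudo-periods. -/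
theorem mem_fatouSetOf_of_comp {f s : ℂ → ℂ} (B : ℝ) (hf : Continuous f) (hs : IsOpenMap s)
    (h : ∀ n, 1 ≤ n → ∃ m, 1 ≤ m ∧ ∃ α β : ℂ, ‖α‖ = 1 ∧ ‖β‖ ≤ B ∧
      ∀ z, f^[n] (s z) = α * f^[m] z + β) {z : ℂ} (hz : z ∈ fatouSetOf f) :
    s z ∈ fatouSetOf f := by
  obtain ⟨r, hr, hn⟩ := hz
  obtain ⟨ρ, hρ, hball⟩ := Metric.isOpen_iff.1 (hs _ isOpen_ball) (s z)
    ⟨z, mem_ball_self (half_pos hr), rfl⟩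
  refine ⟨ρ, hρ, IsNormalOn.of_comp (U := ball z r) (K := closedBall z (r / 2)) (s := s) ?_
    (isCompact_closedBall _ _) (closedBall_subset_ball (by linarith))
    (hball.trans (Set.image_mono ball_subset_closedBall))⟩
  apply hn.of_affine B
  · rintro _ ⟨n, -, rfl⟩
    exact hf.iterate n
  rintro _ ⟨_, ⟨n, hn1, rfl⟩, rfl⟩
  obtain ⟨m, hm, α, β, hα, hβ, hz⟩ := h n hn1
  exact ⟨_, ⟨m, hm, rfl⟩, α, β, hα, hβ, hz⟩

open Metric in
theorem ball_subset_fatouSet {𝓕 : Set (ℂ → ℂ)} {z : ℂ} {r : ℝ} (h : IsNormalOn 𝓕 (ball z r)) :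
    ball z r ⊆ fatouSet 𝓕 := by
  intro w hw
  obtain ⟨ρ, hρ, hsub⟩ := Metric.isOpen_iff.1 isOpen_ball w hw
  exact ⟨ρ, hρ, h.mono hsub subset_rfl⟩

theorem fatouSetOf_subset_iterate (f : ℂ → ℂ) {j : ℕ} (hj : 1 ≤ j) :
    fatouSetOf f ⊆ fatouSetOf f^[j] := by
  rintro z ⟨r, hr, hn⟩
  refine ⟨r, hr, hn.mono subset_rfl ?_⟩
  rintro _ ⟨n, hn1, rfl⟩
  exact ⟨j * n, Nat.mul_pos hj hn1, (Function.iterate_mul f j n).symm⟩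

open Metric in
/-- **Montel's theorem** for holomorphic functions omitting a lattice `p + ℤ x`. -/
theorem isNormalOn_of_ne_add_int_mul {z p x : ℂ} {R : ℝ} (hR : 0 < R) (hx : x ≠ 0) :
    IsNormalOn {h | Differentiable ℂ h ∧ ∀ w ∈ ball z R, ∀ m : ℤ, h w ≠ p + m * x}
      (ball z (R / 4)) := by
  intro u hu
  obtain ⟨k, hk, hlim⟩ := exists_subseq_of_ne_int (φ := fun n w => (u n w - p) / x) hR
    (fun n => (((hu n).1.sub_const p).div_const x).differentiableOn) (fun n w hw m hm =>
      (hu n).2 w hw m (by rw [← hm]; field_simp; ring))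
  refine ⟨k, hk, ?_⟩
  rcases hlim with ⟨η, hη⟩ | hinf
  · refine Or.inl ⟨fun w => η w * x + p, ?_⟩
    rw [Metric.tendstoLocallyUniformlyOn_iff] at hη ⊢
    intro ε hε w hw
    have hx' := norm_pos_iff.2 hx
    obtain ⟨t, ht, hev⟩ := hη (ε / ‖x‖) (by positivity) w hw
    refine ⟨t, ht, ?_⟩
    filter_upwards [hev] with n hn y hy
    have h1 := hn y hy
    rw [dist_eq_norm, lt_div_iff₀ hx', ← norm_mul] at h1
    rw [dist_eq_norm]
    rwa [show η y * x + p - u (k n) y = (η y - (u (k n) y - p) / x) * x by field_simp; ring]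
  · refine Or.inr fun K hK hKc M => ?_
    filter_upwards [hinf K hK hKc ((M + ‖p‖) / ‖x‖)] with n hn w hw
    have h1 := hn w hw
    have hx' := norm_pos_iff.2 hx
    rw [norm_div, div_le_div_iff_of_pos_right hx'] at h1
    linarith [norm_sub_le (u (k n) w) p]

/-! ### Julia sets and pseudo-periods -/

theorem iterate_add_period {f : ℂ → ℂ} {b : ℂ} (h : ∀ w, f (w + b) = f w + b) (n : ℕ) (w : ℂ) :
    f^[n] (w + b) = f^[n] w + b := by
  induction n with
  | zero => rfl
  | succ n ih => rw [Function.iterate_succ_apply', ih, h, Function.iterate_succ_apply']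

/-- A non-affine entire function commuting with a translation has a fixed point of order at most
two. With `h z = f z - z` zero-free, `-h (f z) / h z` would omit `0` and `1`, so by Picard
`h (f z) = κ h z`; a point where `h = b` gives `κ = 1`, and then `h (z + n h z) = h z` makes `h'`
omit `-1` and `-1/2`. -/
theorem exists_fixed_or_fixed_sq {f : ℂ → ℂ} {b : ℂ} (hf : Differentiable ℂ f) (hb : b ≠ 0)
    (hfb : ∀ w, f (w + b) = f w + b) (hna : ¬ ∃ α β : ℂ, ∀ z, f z = α * z + β) :
    ∃ p, f p = p ∨ f (f p) = p := by
  by_contra! hno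
  set h : ℂ → ℂ := fun z => f z - z with hh
  have hd : Differentiable ℂ h := hf.sub differentiable_id
  have hfz : ∀ z, f z = z + h z := fun z => by simp [hh]
  have h0 : ∀ z, h z ≠ 0 := fun z => sub_ne_zero.2 (hno z).1
  have hper : ∀ z, h (z + b) = h z := by
    intro z
    simp only [hh, hfb]
    ring
  have hnc : ¬ ∃ c, ∀ z, h z = c := by
    rintro ⟨c, hc⟩
    exact hna ⟨1, c, fun z => by rw [hfz, hc]; ring⟩
  obtain ⟨κ, hκ⟩ := exists_const_of_forall_ne_of_forall_ne (f := fun z => -h (f z) / h z)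
    ((hd.comp hf).neg.div hd h0) (zero_ne_one (α := ℂ))
    (fun z => div_ne_zero (neg_ne_zero.2 (h0 _)) (h0 z))
    (fun z hz => by
      rw [div_eq_one_iff_eq (h0 z)] at hz
      refine (hno z).2 ?_
      have h1 := hfz (f z)
      have h2 := hfz z
      linear_combination h1 + h2 - hz)
  obtain ⟨w, hw⟩ : ∃ w, h w = b := by
    by_contra! hne
    exact hnc (exists_const_of_forall_ne_of_forall_ne hd hb.symm h0 hne)
  have hκ1 : κ = -1 := by
    rw [← hκ w, hfz w, hw, hper, hw, neg_div, div_self hb]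
  have hinv : ∀ z, h (f z) = h z := by
    intro z
    have h1 := hκ z
    rw [hκ1, div_eq_iff (h0 z)] at h1
    linear_combination -h1
  have hinv2 : ∀ z, h (z + 2 * h z) = h z := by
    intro z
    have h1 : z + 2 * h z = f (f z) := by
      rw [hfz (f z), hinv, hfz z]; ring
    rw [h1, hinv, hinv]
  have hder : ∀ c : ℂ, (∀ z, h (z + c * h z) = h z) → ∀ z,
      deriv h (z + c * h z) * (1 + c * deriv h z) = deriv h z := by
    intro c hc z
    have h1 : HasDerivAt (fun z => z + c * h z) (1 + c * deriv h z) z :=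
      (hasDerivAt_id z).add ((hd z).hasDerivAt.const_mul c)
    have h2 := (hd (z + c * h z)).hasDerivAt.comp z h1
    have h3 : (h ∘ fun z => z + c * h z) = h := funext hc
    rw [h3] at h2
    exact h2.deriv.symm
  have homit : ∀ c : ℂ, c ≠ 0 → (∀ z, h (z + c * h z) = h z) → ∀ z, deriv h z ≠ -1 / c := by
    intro c hc0 hc z hz
    have h1 := hder c hc z
    rw [hz] at h1
    have h2 : 1 + c * (-1 / c) = 0 := by field_simp; ring
    rw [h2, mul_zero] at h1
    exact div_ne_zero (neg_ne_zero.2 one_ne_zero) hc0 h1.symm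
  obtain ⟨c, hc⟩ := exists_const_of_forall_ne_of_forall_ne (f := deriv h)
    (hd.deriv) (p := -1 / 1) (q := -1 / 2) (by norm_num)
    (homit 1 one_ne_zero fun z => by rw [one_mul, ← hfz, hinv]) (homit 2 two_ne_zero hinv2)
  obtain ⟨α, β, hαβ⟩ := exists_affine_of_deriv_eq hd hc
  have h1 := hper 0
  rw [hαβ, hαβ] at h1
  have h2 : α = 0 := by
    have : α * b = 0 := by linear_combination h1
    exact (mul_eq_zero.1 this).resolve_right hb
  exact hnc ⟨β, fun z => by rw [hαβ, h2]; ring⟩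

open Metric in
/-- On a disc of normality, one bounded orbit bounds all orbits nearby, since it rules out `∞` as a
limit. -/
theorem exists_forall_iterate_norm_le {F : ℂ → ℂ} (hF : Continuous F) {z y : ℂ} {r C : ℝ}
    (hr : 0 < r) (hn : IsNormalOn {h | ∃ n : ℕ, 1 ≤ n ∧ h = F^[n]} (ball z r))
    (hy : y ∈ ball z r) (hC : ∀ n, 1 ≤ n → ‖F^[n] y‖ ≤ C) :
    ∃ M : ℝ, ∀ n, 1 ≤ n → ∀ w ∈ ball z (r / 2), ‖F^[n] w‖ ≤ M := by
  by_contra! hcon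
  choose n hn1 w hw hlarge using fun k : ℕ => hcon k
  obtain ⟨l, hl, ⟨η, hη⟩ | hinf⟩ := hn (fun k => F^[n k]) (fun k => ⟨n k, hn1 k, rfl⟩)
  · have hηc : ContinuousOn η (ball z r) :=
      hη.continuousOn (Eventually.of_forall fun k => (hF.iterate _).continuousOn).frequently
    have hK : IsCompact (closedBall z (r / 2)) := isCompact_closedBall _ _
    have hsub : closedBall z (r / 2) ⊆ ball z r := closedBall_subset_ball (by linarith)
    obtain ⟨M, hM⟩ := (hK.image_of_continuousOn (hηc.mono hsub)).isBounded.exists_norm_le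
    have h1 := (tendstoLocallyUniformlyOn_iff_tendstoUniformlyOn_of_compact hK).1 (hη.mono hsub)
    rw [Metric.tendstoUniformlyOn_iff] at h1
    obtain ⟨k, hk1, hk2⟩ := ((h1 1 one_pos).and
      (tendsto_natCast_atTop_atTop.eventually_ge_atTop (M + 1))).exists
    have hwk := ball_subset_closedBall (hw (l k))
    have h2 := hk1 _ hwk
    have h3 := hM _ ⟨_, hwk, rfl⟩
    have h4 := hlarge (l k)
    have h5 : (k : ℝ) ≤ l k := by exact_mod_cast hl.id_le k
    rw [dist_eq_norm, norm_sub_rev] at h2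
    linarith [norm_sub_norm_le (F^[n (l k)] (w (l k))) (η (w (l k)))]
  · obtain ⟨k, hk⟩ := (hinf {y} (by simpa using hy) isCompact_singleton (C + 1)).exists
    have := hk y rfl
    linarith [hC _ (hn1 (l k))]

open Metric in
/-- If the Fatou set is the whole plane and some orbit is bounded, the iterates are locally bounded
everywhere: the set where they are is nonempty, open and closed. -/
theorem iterate_locally_bounded_of_fatouSetOf_eq_univ {F : ℂ → ℂ} (hF : Continuous F)
    (hJ : ∀ z, z ∈ fatouSetOf F) {p : ℂ} (hp : F p = p) (z : ℂ) :
    ∃ r > 0, ∃ M : ℝ, ∀ n, ∀ w ∈ ball z r, ‖F^[n] w‖ ≤ M := by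
  set V : Set ℂ := {z | ∃ r > 0, ∃ M : ℝ, ∀ n, 1 ≤ n → ∀ w ∈ ball z r, ‖F^[n] w‖ ≤ M} with hV
  have hopen : IsOpen V := by
    rw [Metric.isOpen_iff]
    rintro z ⟨r, hr, M, hM⟩
    refine ⟨r, hr, fun w hw => ?_⟩
    obtain ⟨ρ, hρ, hsub⟩ := Metric.isOpen_iff.1 isOpen_ball w hw
    exact ⟨ρ, hρ, M, fun n hn x hx => hM n hn x (hsub hx)⟩
  have hclosed : IsClosed V := by
    rw [← closure_subset_iff_isClosed]
    intro z hz
    obtain ⟨r, hr, hn⟩ := hJ z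
    obtain ⟨y, ⟨ρ, hρ, M, hM⟩, hyz⟩ := Metric.mem_closure_iff.1 hz r hr
    obtain ⟨M', hM'⟩ := exists_forall_iterate_norm_le hF hr hn (y := y) (mem_ball'.2 hyz) (C := M)
      (fun n hn => hM n hn y (mem_ball_self hρ))
    exact ⟨r / 2, by positivity, M', hM'⟩
  have hpV : p ∈ V := by
    obtain ⟨r, hr, hn⟩ := hJ p
    obtain ⟨M', hM'⟩ := exists_forall_iterate_norm_le hF hr hn (mem_ball_self hr) (C := ‖p‖)
      (fun n _ => by rw [Function.iterate_fixed hp])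
    exact ⟨r / 2, by positivity, M', hM'⟩
  have huniv : V = Set.univ := IsClopen.eq_univ ⟨hclosed, hopen⟩ ⟨p, hpV⟩
  obtain ⟨r, hr, M, hM⟩ : z ∈ V := huniv ▸ Set.mem_univ z
  refine ⟨r, hr, max M (‖z‖ + r), fun n w hw => ?_⟩
  rcases Nat.eq_zero_or_pos n with rfl | hn
  · refine le_trans ?_ (le_max_right _ _)
    have := mem_ball_iff_norm.1 hw
    simp only [Function.iterate_zero, id_eq]
    linarith [norm_sub_norm_le w z]
  · exact (hM n hn w hw).trans (le_max_left _ _)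

open Metric in
/-- A locally bounded family of entire functions converges locally uniformly along any
ultrafilter. -/
theorem exists_tendstoLocallyUniformly_ultrafilter {φ : ℕ → ℂ → ℂ} (𝒰 : Ultrafilter ℕ)
    (hφ : ∀ n, Differentiable ℂ (φ n))
    (hbd : ∀ z, ∃ r > 0, ∃ M : ℝ, ∀ n, ∀ w ∈ ball z r, ‖φ n w‖ ≤ M) :
    ∃ η : ℂ → ℂ, Differentiable ℂ η ∧ TendstoLocallyUniformly φ η 𝒰 := by
  have hpt : ∀ z, ∃ y, Tendsto (fun n => φ n z) 𝒰 (𝓝 y) := by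
    intro z
    obtain ⟨r, hr, M, hM⟩ := hbd z
    obtain ⟨y, -, hy⟩ := (isCompact_closedBall (0 : ℂ) M).ultrafilter_le_nhds
      (𝒰.map fun n => φ n z) (by
        rw [le_principal_iff, Ultrafilter.mem_coe, Ultrafilter.mem_map]
        exact Filter.univ_mem' fun n => mem_closedBall_zero_iff.2 (hM n z (mem_ball_self hr)))
    exact ⟨y, hy⟩
  choose η hη using hpt
  have hlu : TendstoLocallyUniformly φ η 𝒰 := by
    rw [Metric.tendstoLocallyUniformly_iff]
    intro ε hε z
    obtain ⟨r, hr, M, hM⟩ := hbd z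
    have hlip : ∀ n, ∀ w ∈ ball z (r / 2), ‖φ n w - φ n z‖ ≤ M / (r / 4) * ‖w - z‖ :=
      fun n w hw => norm_sub_le_of_norm_le_on_ball hr (hφ n).differentiableOn (hM n)
        (mem_closedBall_self (by positivity)) (ball_subset_closedBall hw)
    have hlipη : ∀ w ∈ ball z (r / 2), ‖η w - η z‖ ≤ M / (r / 4) * ‖w - z‖ := fun w hw =>
      le_of_tendsto ((hη w).sub (hη z)).norm (Eventually.of_forall fun n => hlip n w hw)
    have hsmall : ∀ᶠ w in 𝓝 z, M / (r / 4) * ‖w - z‖ < ε / 3 := by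
      have : Tendsto (fun w => M / (r / 4) * ‖w - z‖) (𝓝 z) (𝓝 (M / (r / 4) * ‖z - z‖)) := by
        apply Continuous.tendsto
        fun_prop
      rw [sub_self, norm_zero, mul_zero] at this
      exact this.eventually (gt_mem_nhds (by positivity))
    refine ⟨_, inter_mem hsmall (ball_mem_nhds z (half_pos hr)), ?_⟩
    filter_upwards [Metric.tendsto_nhds.1 (hη z) (ε / 3) (by positivity)] with n hn w hw
    have h1 := hlip n w hw.2
    have h2 := hlipη w hw.2
    have h3 : M / (r / 4) * ‖w - z‖ < ε / 3 := hw.1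
    rw [dist_eq_norm] at hn ⊢
    have h4 : η w - φ n w = (η w - η z) - (φ n w - φ n z) - (φ n z - η z) := by ring
    rw [h4]
    have h5 := norm_sub_le (η w - η z - (φ n w - φ n z)) (φ n z - η z)
    have h6 := norm_sub_le (η w - η z) (φ n w - φ n z)
    linarith
  refine ⟨η, ?_, hlu⟩
  rw [← differentiableOn_univ]
  exact (tendstoLocallyUniformlyOn_univ.2 hlu).differentiableOn
    (Eventually.of_forall fun n => (hφ n).differentiableOn) isOpen_univ

theorem TendstoLocallyUniformly.tendsto_apply {φ : ℕ → ℂ → ℂ} {η : ℂ → ℂ} {l : Filter ℕ}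
    (h : TendstoLocallyUniformly φ η l) (z : ℂ) : Tendsto (fun n => φ n z) l (𝓝 (η z)) :=
  (tendstoLocallyUniformlyOn_univ.2 h).tendsto_at (Set.mem_univ z)

open Metric in
/-- An entire function with two fixed points whose Fatou set is the whole plane is injective. Along
an ultrafilter, `F^[n] → η` with `η` nonconstant; the limit `ψ` of `F^[m - n]` satisfies
`ψ ∘ η = η`, so `ψ = id`, whereas `ψ` identifies points identified by `F`. -/
theorem injective_of_fatouSetOf_eq_univ {F : ℂ → ℂ} (hF : Differentiable ℂ F)
    (hJ : ∀ z, z ∈ fatouSetOf F) {p q : ℂ} (hpq : p ≠ q) (hp : F p = p) (hq : F q = q) :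
    Function.Injective F := by
  have hbd := iterate_locally_bounded_of_fatouSetOf_eq_univ hF.continuous hJ hp
  have hit : ∀ n, Differentiable ℂ F^[n] := fun n => hF.iterate n
  set 𝒰 := hyperfilter ℕ
  have hle : (𝒰 : Filter ℕ) ≤ atTop := Nat.hyperfilter_le_atTop
  obtain ⟨η, hηd, hη⟩ := exists_tendstoLocallyUniformly_ultrafilter 𝒰 hit hbd
  choose ψ' hψ'd hψ' using fun n : ℕ => exists_tendstoLocallyUniformly_ultrafilter 𝒰
    (φ := fun m => F^[m - n]) (fun m => hit _)
    (fun z => by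
      obtain ⟨r, hr, M, hM⟩ := hbd z
      exact ⟨r, hr, M, fun m w hw => hM _ w hw⟩)
  obtain ⟨ψ, hψd, hψ⟩ := exists_tendstoLocallyUniformly_ultrafilter 𝒰 hψ'd (fun z => by
      obtain ⟨r, hr, M, hM⟩ := hbd z
      exact ⟨r, hr, M, fun n w hw => le_of_tendsto ((hψ' n).tendsto_apply w).norm
        (Eventually.of_forall fun m => hM _ w hw)⟩)
  have hψη' : ∀ n z, ψ' n (F^[n] z) = η z := by
    intro n z
    refine tendsto_nhds_unique ((hψ' n).tendsto_apply (F^[n] z)) ((hη.tendsto_apply z).congr' ?_)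
    filter_upwards [hle (eventually_ge_atTop n)] with m hm
    rw [← Function.iterate_add_apply, Nat.sub_add_cancel hm]
  have hψη : ∀ z, ψ (η z) = η z := by
    intro z
    have h1 : Tendsto (fun n => ψ' n (F^[n] z)) 𝒰 (𝓝 (ψ (η z))) :=
      hψ.tendsto_comp hψd.continuous.continuousAt (hη.tendsto_apply z)
    simp only [hψη'] at h1
    exact tendsto_nhds_unique h1 tendsto_const_nhds
  have hfix : ∀ x, F x = x → η x = x := by
    intro x hx
    have h1 := hη.tendsto_apply x
    simp only [Function.iterate_fixed hx] at h1
    exact tendsto_nhds_unique h1 tendsto_const_nhds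
  have hopen : IsOpenMap η := by
    refine isOpenMap_of_not_const hηd ?_
    rintro ⟨c, hc⟩
    exact hpq (by rw [← hfix p hp, ← hfix q hq, hc, hc])
  have hψid : ψ = id := by
    refine AnalyticOnNhd.eq_of_eventuallyEq (fun z _ => hψd.analyticAt z)
      (fun z _ => analyticAt_id) (z₀ := η 0) ?_
    filter_upwards [hopen.isOpen_range.mem_nhds (Set.mem_range_self 0)]
    rintro _ ⟨z, rfl⟩
    exact hψη z
  intro x y hxy
  have h1 : ∀ n, ψ' n x = ψ' n y := by
    intro n
    refine tendsto_nhds_unique ((hψ' n).tendsto_apply x)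
      (((hψ' n).tendsto_apply y).congr' ?_)
    filter_upwards [hle (eventually_gt_atTop n)] with m hm
    obtain ⟨j, hj⟩ : ∃ j, m - n = j + 1 := ⟨m - n - 1, by omega⟩
    rw [hj, Function.iterate_succ_apply, Function.iterate_succ_apply, hxy]
  have h2 : ψ x = ψ y := tendsto_nhds_unique (hψ.tendsto_apply x)
    ((hψ.tendsto_apply y).congr fun n => (h1 n).symm)
  simpa [hψid] using h2

/-- A non-affine entire function commuting with a translation has a nonempty Julia set. -/
theorem exists_notMem_fatouSetOf {f : ℂ → ℂ} {b : ℂ} (hf : Differentiable ℂ f) (hb : b ≠ 0)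
    (hfb : ∀ w, f (w + b) = f w + b) (hna : ¬ ∃ α β : ℂ, ∀ z, f z = α * z + β) :
    ∃ p, p ∉ fatouSetOf f := by
  by_contra! hJ
  obtain ⟨j, hj, p, hp⟩ : ∃ j, 1 ≤ j ∧ ∃ p, f^[j] p = p := by
    obtain ⟨p, hp | hp⟩ := exists_fixed_or_fixed_sq hf hb hfb hna
    · exact ⟨1, le_rfl, p, hp⟩
    · exact ⟨2, one_le_two, p, hp⟩
  have hinj : Function.Injective f^[j] := injective_of_fatouSetOf_eq_univ (hf.iterate j)
    (fun z => fatouSetOf_subset_iterate f hj (hJ z)) (p := p) (q := p + b) (by simpa using hb)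
    hp (by rw [iterate_add_period hfb, hp])
  refine hna (exists_affine_of_injective hf fun x y hxy => hinj ?_)
  obtain ⟨i, rfl⟩ : ∃ i, j = i + 1 := ⟨j - 1, by omega⟩
  rw [Function.iterate_succ_apply, Function.iterate_succ_apply, hxy]

open Metric in
/-- Translating the iterates by arbitrary multiples of a pseudo-period `x` does not destroy
normality: on a disc of `F(f)` every iterate of `f` omits `p + ℤ x`, where `p` is a point of the
Julia set, and so do its translates; Montel's theorem applies to them all. -/
theorem fatouSetOf_subset_of_int_translate {f g : ℂ → ℂ} {x ε : ℂ} (B : ℝ)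
    (hf : Differentiable ℂ f) (hx : x ≠ 0) (hε : ε ^ 2 = 1)
    (hfx : ∀ w, f (w + x) = f w + ε * x) (hna : ¬ ∃ α β : ℂ, ∀ z, f z = α * z + β)
    (hfg : ∀ n, 1 ≤ n → ∃ α β : ℂ, ∃ k : ℤ, ‖α‖ = 1 ∧ ‖β‖ ≤ B ∧
      ∀ z, g^[n] z = α * (f^[n] z + k * x) + β) :
    fatouSetOf f ⊆ fatouSetOf g := by
  have hopen : IsOpenMap f := isOpenMap_of_not_const hf fun ⟨c, hc⟩ =>
    hna ⟨0, c, fun z => by rw [hc]; ring⟩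
  have hε1 : ‖ε‖ = 1 := by
    have := congrArg norm hε
    rw [norm_pow, norm_one] at this
    exact (pow_eq_one_iff_of_nonneg (norm_nonneg _) two_ne_zero).1 this
  have hfk : ∀ (n : ℕ) (w : ℂ), f^[n] (w + x) = f^[n] w + ε ^ n * x ∧
      f^[n] (w - x) = f^[n] w - ε ^ n * x := by
    have hfm : ∀ w, f (w - x) = f w - ε * x := fun w => by
      have := hfx (w - x)
      rw [sub_add_cancel] at this
      rw [this]; ring
    intro n
    induction n with
    | zero => intro w; simp
    | succ n ih =>
      intro w
      rw [Function.iterate_succ_apply, Function.iterate_succ_apply, Function.iterate_succ_apply,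
        hfx, hfm]
      -- `ε = ±1`, so that the translation by `ε * x` is one of those covered by the induction.
      rcases mul_self_eq_one_iff.1 (show ε * ε = 1 by rw [← sq, hε]) with rfl | rfl
      · simpa using ih (f w)
      · have h1 := ih (f w)
        constructor
        · rw [neg_one_mul, ← sub_eq_add_neg, h1.2, pow_succ]; ring
        · rw [neg_one_mul, sub_neg_eq_add, h1.1, pow_succ]; ring
  obtain ⟨p, hp⟩ : ∃ p, p ∉ fatouSetOf f := by
    obtain ⟨p, hp⟩ := exists_notMem_fatouSetOf (f := f^[2]) (hf.iterate 2) hx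
      (fun w => by rw [(hfk 2 w).1, hε, one_mul]) (by
        rintro ⟨α, β, hαβ⟩
        have hα : α ≠ 0 := by
          rintro rfl
          have h1 := (hfk 2 0).1
          rw [hε, one_mul, hαβ, hαβ] at h1
          apply hx
          linear_combination -h1
        refine hna (exists_affine_of_injective hf fun y z hyz => ?_)
        have h1 : f^[2] y = f^[2] z := by
          change f (f y) = f (f z)
          rw [hyz]
        rw [hαβ, hαβ] at h1
        exact mul_left_cancel₀ hα (add_right_cancel h1))
    exact ⟨p, fun h => hp (fatouSetOf_subset_iterate f one_le_two h)⟩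
  have hforward : ∀ (n : ℕ) {z : ℂ}, z ∈ fatouSetOf f → f^[n] z ∈ fatouSetOf f := by
    intro n
    induction n with
    | zero => exact fun h => h
    | succ n ih =>
      intro z hz
      refine ih (mem_fatouSetOf_of_comp 0 hf.continuous hopen (fun m hm => ?_) hz)
      exact ⟨m + 1, by omega, 1, 0, by simp, by simp, fun w => by
        rw [Function.iterate_succ_apply]; ring⟩
  have hplus : ∀ z ∈ fatouSetOf f, z + x ∈ fatouSetOf f := by
    intro z hz
    refine mem_fatouSetOf_of_comp (s := fun w => w + x) ‖x‖ hf.continuous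
      (Homeomorph.addRight x).isOpenMap (fun m hm => ?_) hz
    exact ⟨m, hm, 1, ε ^ m * x, by simp, by simp [hε1], fun w => by rw [(hfk m w).1]; ring⟩
  have hminus : ∀ z ∈ fatouSetOf f, z - x ∈ fatouSetOf f := by
    intro z hz
    refine mem_fatouSetOf_of_comp (s := fun w => w - x) ‖x‖ hf.continuous
      (Homeomorph.subRight x).isOpenMap (fun m hm => ?_) hz
    exact ⟨m, hm, 1, -(ε ^ m * x), by simp, by simp [hε1], fun w => by rw [(hfk m w).2]; ring⟩
  have hlat : ∀ k : ℤ, p + k * x ∉ fatouSetOf f := by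
    intro k
    induction k using Int.induction_on with
    | zero => simpa using hp
    | succ k ih =>
      intro h
      apply ih
      have := hminus _ h
      convert this using 1
      push_cast
      ring
    | pred k ih =>
      intro h
      apply ih
      have := hplus _ h
      convert this using 1
      push_cast
      ring
  rintro z ⟨r, hr, hn⟩
  have hsub : ball z r ⊆ fatouSetOf f := ball_subset_fatouSet hn
  refine ⟨r / 4, by positivity, (isNormalOn_of_ne_add_int_mul (p := p) hr hx).of_affine B
    (fun h hh => hh.1.continuous) ?_⟩
  rintro _ ⟨n, hn1, rfl⟩
  obtain ⟨α, β, k, hα, hβ, hz⟩ := hfg n hn1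
  refine ⟨fun w => f^[n] w + k * x, ⟨(hf.iterate n).add_const _, fun w hw m hm => ?_⟩, α, β, hα, hβ,
    hz⟩
  refine hlat (m - k) ?_
  have h1 := hforward n (hsub hw)
  rwa [show f^[n] w = p + ((m - k : ℤ) : ℂ) * x by push_cast; linear_combination hm] at h1

/-! ### Commutators and pseudo-periods -/

theorem comp_mem_generatedSemigroup {S : Set (ℂ → ℂ)} {h k : ℂ → ℂ}
    (hh : h ∈ generatedSemigroup S) (hk : k ∈ generatedSemigroup S) :
    h ∘ k ∈ generatedSemigroup S :=
  (Subsemigroup.closure (show Set (Function.End ℂ) from S)).mul_mem hh hk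

theorem mem_generatedSemigroup_of_mem {S : Set (ℂ → ℂ)} {h : ℂ → ℂ} (hh : h ∈ S) :
    h ∈ generatedSemigroup S :=
  Subsemigroup.subset_closure (s := show Set (Function.End ℂ) from S) hh

theorem iterate_mem_generatedSemigroup {S : Set (ℂ → ℂ)} {h : ℂ → ℂ} (hh : h ∈ S) {n : ℕ}
    (hn : 1 ≤ n) : h^[n] ∈ generatedSemigroup S := by
  induction n, hn using Nat.le_induction with
  | base => exact mem_generatedSemigroup_of_mem hh
  | succ n _ ih =>
    rw [Function.iterate_succ]
    exact comp_mem_generatedSemigroup ih (mem_generatedSemigroup_of_mem hh)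

/-- In a nearly abelian semigroup whose commutators are real translations, precompactness bounds
the translations. -/
theorem IsNearlyAbelian.exists_real_translation {G : Set (ℂ → ℂ)} (hG : IsNearlyAbelian G)
    (hΦ : semigroupCommutatorSet G ⊆ {φ | ∃ c : ℝ, ∀ z, φ z = z + (c : ℂ)}) :
    ∃ B : ℝ, ∀ h ∈ G, ∀ k ∈ G, ∃ c : ℝ, |c| ≤ B ∧ ∀ z, h (k z) = k (h z) + c := by
  obtain ⟨Φ, ⟨haff, hpre⟩, -, hcomm⟩ := hG
  by_contra! hcon
  choose h hh k hk hbad using fun n : ℕ => hcon n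
  choose φ hφ hφeq using fun n => hcomm (h n) (hh n) (k n) (hk n)
  choose c hc using fun n =>
    hΦ (show φ n ∈ semigroupCommutatorSet G from ⟨haff _ (hφ n), h n, hh n, k n, hk n, hφeq n⟩)
  have hlarge : ∀ n : ℕ, (n : ℝ) < |c n| := by
    intro n
    by_contra hle
    obtain ⟨z, hz⟩ := hbad n (c n) (not_lt.1 hle)
    refine hz ?_
    have := congrFun (hφeq n) z
    simp only [Function.comp_apply] at this
    rw [this, hc]
  obtain ⟨l, hl, ψ, -, hψ⟩ := hpre φ hφ
  have h1 : Tendsto (fun n => ‖φ (l n) 0‖) atTop (𝓝 ‖ψ 0‖) := (hψ.tendsto_apply 0).norm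
  have h2 : Tendsto (fun n => ‖φ (l n) 0‖) atTop atTop := by
    refine tendsto_atTop_mono (fun n => ?_) tendsto_natCast_atTop_atTop
    rw [hc, zero_add, Complex.norm_real, Real.norm_eq_abs]
    have : (n : ℝ) ≤ l n := by exact_mod_cast hl.id_le n
    linarith [hlarge (l n)]
  exact not_tendsto_nhds_of_tendsto_atTop h2 _ h1

theorem isOpenMap_iterate {f : ℂ → ℂ} (hf : IsOpenMap f) (n : ℕ) : IsOpenMap f^[n] := by
  induction n with
  | zero => exact IsOpenMap.id
  | succ n ih => exact ih.comp hf

theorem eq_of_comp_eq {f u v : ℂ → ℂ} (hf : IsOpenMap f) (hu : Differentiable ℂ u)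
    (hv : Differentiable ℂ v) (h : ∀ z, u (f z) = v (f z)) : u = v := by
  refine AnalyticOnNhd.eq_of_eventuallyEq (fun z _ => hu.analyticAt z)
    (fun z _ => hv.analyticAt z) (z₀ := f 0) ?_
  filter_upwards [hf.isOpen_range.mem_nhds (Set.mem_range_self 0)]
  rintro _ ⟨z, rfl⟩
  exact h z

theorem eq_of_scaling_invariant_of_norm_lt_one {φ : ℂ → ℂ} (hφ : Continuous φ) {a p : ℂ}
    (ha : ‖a‖ < 1) (h : ∀ u, φ (p + a * u) = φ (p + u)) (v : ℂ) : φ v = φ p := by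
  have h1 : ∀ n : ℕ, φ (p + a ^ n * (v - p)) = φ v := by
    intro n
    induction n with
    | zero => simp
    | succ n ih => rw [pow_succ', mul_assoc, h, ih]
  have h2 : Tendsto (fun n : ℕ => φ (p + a ^ n * (v - p))) atTop
      (𝓝 (φ (p + 0 * (v - p)))) :=
    (hφ.tendsto _).comp (((tendsto_pow_atTop_nhds_zero_of_norm_lt_one ha).mul_const _).const_add p)
  simp only [h1, zero_mul, add_zero] at h2
  exact tendsto_nhds_unique tendsto_const_nhds h2

theorem eq_of_scaling_invariant {φ : ℂ → ℂ} (hφ : Continuous φ) {a p : ℂ} (ha0 : a ≠ 0)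
    (ha : ‖a‖ ≠ 1) (h : ∀ u, φ (p + a * u) = φ (p + u)) (v : ℂ) : φ v = φ p := by
  rcases ha.lt_or_gt with hlt | hgt
  · exact eq_of_scaling_invariant_of_norm_lt_one hφ hlt h v
  · refine eq_of_scaling_invariant_of_norm_lt_one hφ (a := a⁻¹) ?_ (fun u => ?_) v
    · rw [norm_inv]
      exact inv_lt_one_of_one_lt₀ hgt
    · rw [← h (a⁻¹ * u), mul_inv_cancel_left₀ ha0]

/-- An entire function with two periods independent over `ℝ` is constant. -/
theorem exists_const_of_periodic_of_periodic {φ : ℂ → ℂ} (hφ : Differentiable ℂ φ) {x a : ℂ}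
    (hx : x ≠ 0) (ha : a.im ≠ 0) (h1 : Function.Periodic φ x) (h2 : Function.Periodic φ (a * x)) :
    ∃ c, ∀ z, φ z = c := by
  apply hφ.exists_const_forall_eq_of_bounded
  refine ((isCompact_closedBall (0 : ℂ) ((1 + ‖a‖) * ‖x‖)).image hφ.continuous).isBounded.subset ?_
  rintro _ ⟨z, rfl⟩
  set t : ℝ := (z / x).im / a.im
  set s : ℝ := (z / x).re - t * a.re
  have hz : z = (s + t * a) * x := by
    have : z / x = s + t * a := by
      apply Complex.ext
      · simp [s]
      · simp [t, div_mul_cancel₀ _ ha]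
    rw [← this, div_mul_cancel₀ _ hx]
  refine ⟨z - ⌊s⌋ * x - ⌊t⌋ * (a * x), ?_, ?_⟩
  · rw [mem_closedBall_zero_iff]
    have h3 : z - ⌊s⌋ * x - ⌊t⌋ * (a * x) =
        ((Int.fract s : ℝ) + (Int.fract t : ℝ) * a) * x := by
      rw [← Int.self_sub_floor, ← Int.self_sub_floor]
      push_cast
      rw [sub_mul, add_mul, sub_mul]
      linear_combination hz
    rw [h3, norm_mul]
    gcongr
    refine (norm_add_le _ _).trans (add_le_add ?_ ?_)
    · rw [Complex.norm_real, Real.norm_eq_abs, abs_of_nonneg (Int.fract_nonneg _)]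
      exact (Int.fract_lt_one _).le
    · rw [norm_mul, Complex.norm_real, Real.norm_eq_abs, abs_of_nonneg (Int.fract_nonneg _)]
      exact mul_le_of_le_one_left (norm_nonneg _) (Int.fract_lt_one _).le
  · rw [(h2.int_mul ⌊t⌋).sub_eq, (h1.int_mul ⌊s⌋).sub_eq]

theorem deriv_periodic_of_add_eq {f : ℂ → ℂ} {x e : ℂ} (h : ∀ v, f (v + x) = f v + e) :
    Function.Periodic (deriv f) x := by
  intro v
  rw [← deriv_comp_add_const]
  simp only [h, deriv_add_const]

/-- The increment of `f` along a real pseudo-period is proportional to the pseudo-period, because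
`f z - l z` is bounded on the real line. -/
theorem increment_eq_of_real_pseudoperiod {f : ℂ → ℂ} (hf : Continuous f) {x l y : ℝ} {e : ℂ}
    (hx : x ≠ 0) (hfx : ∀ v, f (v + x) = f v + l * x) (hfy : ∀ v, f (v + y) = f v + e) :
    e = l * y := by
  set h : ℝ → ℂ := fun t => f t - l * t with hh
  have hcont : Continuous h := by fun_prop
  have hper : Function.Periodic h x := by
    intro t
    simp only [hh]
    push_cast
    rw [hfx]
    ring
  obtain ⟨M, hM⟩ := ((isCompact_closedBall (0 : ℝ) |x|).image hcont).isBounded.exists_norm_le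
  have hbd : ∀ t, ‖h t‖ ≤ M := by
    intro t
    have h1 : h (t - ⌊t / x⌋ * x) = h t := (hper.int_mul _).sub_eq t
    rw [← h1]
    refine hM _ ⟨_, ?_, rfl⟩
    rw [mem_closedBall_zero_iff, Real.norm_eq_abs]
    have h2 : t - ⌊t / x⌋ * x = Int.fract (t / x) * x := by
      rw [← Int.self_sub_floor, sub_mul, div_mul_cancel₀ _ hx]
    rw [h2, abs_mul, abs_of_nonneg (Int.fract_nonneg _)]
    exact mul_le_of_le_one_left (abs_nonneg _) (Int.fract_lt_one _).le
  have hlin : ∀ n : ℕ, h (n * y) = h 0 + n * (e - l * y) := by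
    intro n
    induction n with
    | zero => simp
    | succ n ih =>
      have h1 : h ((n + 1 : ℕ) * y) = h (n * y) + (e - l * y) := by
        simp only [hh]
        push_cast
        rw [add_mul, one_mul, hfy]
        ring
      rw [h1, ih]
      push_cast
      ring
  by_contra hne
  have hpos : 0 < ‖e - l * y‖ := norm_pos_iff.2 (sub_ne_zero.2 hne)
  obtain ⟨n, hn⟩ := exists_nat_gt ((M + M) / ‖e - l * y‖)
  rw [div_lt_iff₀ hpos] at hn
  have h1 : (n : ℂ) * (e - l * y) = h (n * y) - h 0 := by rw [hlin]; ring
  have h2 := norm_sub_le (h (n * y)) (h 0)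
  rw [← h1, norm_mul, Complex.norm_natCast] at h2
  linarith [hbd (n * y), hbd 0]

/-- Bounded pseudo-periods `l ^ n * x` of a non-affine entire function cannot accumulate at `0`, so
`l ∈ {0, 1, -1}`. -/
theorem eq_zero_or_one_or_neg_one_of_pseudoperiods {f : ℂ → ℂ} (hf : Differentiable ℂ f)
    (hna : ¬ ∃ α β : ℂ, ∀ z, f z = α * z + β) {x l B : ℝ} (hx : x ≠ 0)
    (hB : ∀ n : ℕ, 1 ≤ n → |l ^ n * x| ≤ B)
    (hp : ∀ n : ℕ, 1 ≤ n → ∃ e : ℂ, ∀ v, f (v + (l ^ n * x : ℝ)) = f v + e) :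
    l = 0 ∨ l = 1 ∨ l = -1 := by
  have hle : |l| ≤ 1 := by
    by_contra! hgt
    have h1 : Tendsto (fun n : ℕ => |l| ^ n * |x|) atTop atTop :=
      (tendsto_pow_atTop_atTop_of_one_lt hgt).atTop_mul_const (abs_pos.2 hx)
    obtain ⟨n, hn, hn1⟩ := ((h1.eventually_gt_atTop B).and (eventually_ge_atTop 1)).exists
    have := hB n hn1
    rw [abs_mul, abs_pow] at this
    linarith
  by_contra! hne
  have hlt : |l| < 1 := by
    refine lt_of_le_of_ne hle fun h => ?_
    rcases eq_or_eq_neg_of_abs_eq h with h | h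
    · exact hne.2.1 h
    · exact hne.2.2 h
  have hlim : Tendsto (fun n : ℕ => ((l ^ n * x : ℝ) : ℂ)) atTop (𝓝[≠] 0) := by
    rw [tendsto_nhdsWithin_iff]
    constructor
    · have h1 : Tendsto (fun n : ℕ => l ^ n * x) atTop (𝓝 (0 * x)) :=
        (tendsto_pow_atTop_nhds_zero_of_abs_lt_one hlt).mul_const x
      rw [zero_mul] at h1
      have h2 := (Complex.continuous_ofReal.tendsto 0).comp h1
      rwa [Complex.ofReal_zero] at h2
    · refine Eventually.of_forall fun n => ?_
      simp [hne.1, hx]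
  refine hna (exists_affine_of_deriv_eq hf (c := deriv f 0) fun z => ?_)
  have hfreq : ∃ᶠ z in 𝓝[≠] (0 : ℂ), deriv f z = (fun _ => deriv f 0) z := by
    refine hlim.frequently (Eventually.frequently ?_)
    filter_upwards [eventually_ge_atTop 1] with n hn
    obtain ⟨e, he⟩ := hp n hn
    have := deriv_periodic_of_add_eq he 0
    rwa [zero_add] at this
  exact congrFun (AnalyticOnNhd.eq_of_frequently_eq (fun z _ => hf.deriv.analyticAt z)
    (fun z _ => analyticAt_const) hfreq) z

theorem fatouSetOf_eq_of_affine {f g : ℂ → ℂ} (B : ℝ) (hf : Continuous f) (hg : Continuous g)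
    (h : ∀ n, 1 ≤ n → ∃ α β : ℂ, ‖α‖ = 1 ∧ ‖β‖ ≤ B ∧ ∀ z, g^[n] z = α * f^[n] z + β) :
    fatouSetOf f = fatouSetOf g := by
  refine (fatouSetOf_subset_of_affine B hf h).antisymm (fatouSetOf_subset_of_affine B hg ?_)
  intro n hn
  obtain ⟨α, β, hα, hβ, hz⟩ := h n hn
  have hα0 : α ≠ 0 := norm_ne_zero_iff.1 (by rw [hα]; exact one_ne_zero)
  refine ⟨α⁻¹, -(α⁻¹ * β), by rw [norm_inv, hα, inv_one],
    by rwa [norm_neg, norm_mul, norm_inv, hα, inv_one, one_mul], fun z => ?_⟩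
  rw [hz]
  field_simp
  ring

/-! ### Comparison of the two Fatou sets -/

/-- The Fatou sets of `f` and `g = f + b` agree if `f` increases by `l * b` along `b` and the
commutators `c` of the iterates with `g` are bounded. The increment of `f^[n]` along `b` is
`l ^ n * b`, so `l ∈ {0, 1, -1}`; only for `l = 1` do the iterates of `f` and `g` differ by an
unbounded translation. -/
theorem fatouSetOf_eq_of_add {f g : ℂ → ℂ} {b l B : ℝ} (hf : Differentiable ℂ f)
    (hna : ¬ ∃ α β : ℂ, ∀ z, f z = α * z + β) (hb : b ≠ 0) (hg : ∀ z, g z = f z + b)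
    (hfb : ∀ v, f (v + b) = f v + l * b)
    (hc : ∀ n, 1 ≤ n → ∃ c : ℝ, |c| ≤ B ∧ ∀ v, f^[n] (v + b) = f^[n] v + b + c) :
    fatouSetOf f = fatouSetOf g := by
  have hbC : (b : ℂ) ≠ 0 := Complex.ofReal_ne_zero.2 hb
  have hgd : Differentiable ℂ g := by
    rw [show g = fun z => f z + b from funext hg]
    exact hf.add_const _
  have hopen : IsOpenMap f := isOpenMap_of_not_const hf fun ⟨c, hc⟩ =>
    hna ⟨0, c, fun z => by rw [hc]; ring⟩
  have hstep : ∀ n, ∀ v, f^[n] (v + b) = f^[n] v + (l ^ n * b : ℝ) ∧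
      f (v + (l ^ n * b : ℝ)) = f v + (l ^ (n + 1) * b : ℝ) := by
    have hnext : ∀ n, (∀ v, f^[n] (v + b) = f^[n] v + (l ^ n * b : ℝ)) →
        ∀ v, f (v + (l ^ n * b : ℝ)) = f v + (l ^ (n + 1) * b : ℝ) := by
      intro n hn v
      obtain ⟨c, -, hcn⟩ := hc (n + 1) (by omega)
      have h1 : (fun v => f (v + (l ^ n * b : ℝ))) = fun v => f v + ((b + c : ℝ) : ℂ) := by
        refine eq_of_comp_eq (f := f^[n]) (isOpenMap_iterate hopen n) (by fun_prop) (by fun_prop) fun z => ?_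
        rw [← hn, ← Function.iterate_succ_apply' f n, ← Function.iterate_succ_apply' f n, hcn]
        push_cast
        ring
      have h2 := increment_eq_of_real_pseudoperiod hf.continuous hb hfb (fun v => congrFun h1 v)
      have h3 := congrFun h1 v
      rw [h3, h2]
      push_cast
      ring
    intro n
    induction n with
    | zero => exact fun v => ⟨by simp, hnext 0 (fun v => by simp) v⟩
    | succ n ih =>
      have h1 : ∀ v, f^[n + 1] (v + b) = f^[n + 1] v + (l ^ (n + 1) * b : ℝ) := fun v => by
        rw [Function.iterate_succ_apply', (ih v).1, (ih _).2, Function.iterate_succ_apply']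
      exact fun v => ⟨h1 v, hnext _ h1 v⟩
  have hl := eq_zero_or_one_or_neg_one_of_pseudoperiods hf hna hb (B := |b| + B) (l := l)
    (fun n hn => by
      obtain ⟨c, hcB, hcn⟩ := hc n hn
      have h1 := (hstep n 0).1
      rw [hcn, add_assoc, add_right_inj] at h1
      have h2 : b + c = l ^ n * b := by exact_mod_cast h1
      rw [← h2]
      linarith [abs_add_le b c])
    (fun n _ => ⟨_, fun v => (hstep n v).2⟩)
  rcases hl with rfl | rfl | rfl
  · refine fatouSetOf_eq_of_affine |b| hf.continuous hgd.continuous fun n hn => ?_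
    refine ⟨1, b, by simp, by simp, ?_⟩
    induction n, hn using Nat.le_induction with
    | base => intro z; simp [hg]
    | succ n _ ih =>
      intro z
      rw [Function.iterate_succ_apply', ih, one_mul, hg, hfb, Function.iterate_succ_apply']
      simp
  · simp only [Complex.ofReal_one, one_mul] at hfb
    have hgn : ∀ (n : ℕ) z, g^[n] z = f^[n] z + n * b := by
      intro n
      induction n with
      | zero => simp
      | succ n ih =>
        intro z
        have hper : Function.Periodic (fun v => f v - v) b := fun v => by
          simp only [hfb]; ring
        have h1 := hper.nat_mul n (f^[n] z)
        rw [Function.iterate_succ_apply', ih, hg, Function.iterate_succ_apply']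
        push_cast
        linear_combination h1
    refine (fatouSetOf_subset_of_int_translate 0 hf hbC (one_pow 2) (fun w => by rw [hfb, one_mul])
      hna fun n _ => ⟨1, 0, n, by simp, by simp, fun z => by rw [hgn]; push_cast; ring⟩).antisymm
      (fatouSetOf_subset_of_int_translate 0 hgd hbC (one_pow 2)
        (fun w => by rw [hg, hg, hfb]; ring) ?_
        fun n _ => ⟨1, 0, -n, by simp, by simp, fun z => by rw [hgn]; push_cast; ring⟩)
    rintro ⟨α, β, h⟩
    exact hna ⟨α, β - b, fun z => by linear_combination h z - hg z⟩
  · refine fatouSetOf_eq_of_affine |b| hf.continuous hgd.continuous fun n hn => ?_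
    suffices h : (∀ z, g^[n] z = f^[n] z) ∨ ∀ z, g^[n] z = f^[n] z + b by
      rcases h with h | h
      · exact ⟨1, 0, by simp, by simp, fun z => by rw [h]; ring⟩
      · exact ⟨1, b, by simp, by simp, fun z => by rw [h]; ring⟩
    clear hn
    induction n with
    | zero => simp
    | succ n ih =>
      rcases ih with ih | ih
      · right
        intro z
        rw [Function.iterate_succ_apply', ih, hg, Function.iterate_succ_apply']
      · left
        intro z
        rw [Function.iterate_succ_apply', ih, hg, Function.iterate_succ_apply', hfb]
        simp

/-- The Fatou sets of `f` and `g = -f + b` agree if the commutator `c 1 = x` of `f` with `g` does not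
vanish and the commutators `c n` of `f^[n]` with `g` are bounded. They satisfy
`c (n + 1) = x + l * c n`, so the pseudo-periods `l ^ n * x = c (n + 1) - c n` force `l ∈ {0, -1}`;
for `l = -1` the iterates of `f` and `g` differ by an isometry and an unbounded multiple of `x`. -/
theorem fatouSetOf_eq_of_neg_add {f g : ℂ → ℂ} {b x l B : ℝ} (hf : Differentiable ℂ f)
    (hna : ¬ ∃ α β : ℂ, ∀ z, f z = α * z + β) (hx : x ≠ 0) (hg : ∀ z, g z = -f z + b)
    (hfL : ∀ v, f (-v + b) = -f v + b + x) (hfx : ∀ v, f (v + x) = f v + l * x)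
    (c : ℕ → ℝ) (hc1 : c 1 = x) (hcB : ∀ n, 1 ≤ n → |c n| ≤ B)
    (hfc : ∀ n, 1 ≤ n → ∀ v, f (v + c n) = f v + (c (n + 1) - c 1 : ℝ)) :
    fatouSetOf f = fatouSetOf g := by
  have hxC : (x : ℂ) ≠ 0 := Complex.ofReal_ne_zero.2 hx
  have hgd : Differentiable ℂ g := by
    rw [show g = fun z => -f z + b from funext hg]
    exact hf.neg.add_const _
  have hrec : ∀ n, 1 ≤ n → c (n + 1) = x + l * c n := by
    intro n hn
    have h1 := increment_eq_of_real_pseudoperiod hf.continuous hx hfx (hfc n hn)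
    have h2 : c (n + 1) - c 1 = l * c n := by exact_mod_cast h1
    linarith
  have hdiff : ∀ n, 1 ≤ n → l ^ n * x = c (n + 1) - c n := by
    intro n hn
    induction n, hn using Nat.le_induction with
    | base => rw [hrec 1 le_rfl, hc1]; ring
    | succ n hn ih =>
      rw [hrec (n + 1) (by omega), pow_succ', mul_assoc, ih]
      linarith [hrec n hn]
  have hl := eq_zero_or_one_or_neg_one_of_pseudoperiods hf hna hx (B := B + B) (l := l)
    (fun n hn => by
      rw [hdiff n hn]
      linarith [abs_sub (c (n + 1)) (c n), hcB n hn, hcB (n + 1) (by omega)])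
    (fun n hn => by
      refine ⟨(c (n + 2) - c 1 : ℝ) - (c (n + 1) - c 1 : ℝ), fun v => ?_⟩
      have h1 := hfc n hn (v - c n)
      have h2 := hfc (n + 1) (by omega) (v - c n)
      rw [sub_add_cancel] at h1
      rw [hdiff n hn, show v + ((c (n + 1) - c n : ℝ) : ℂ) = v - c n + c (n + 1) by
        push_cast; ring, h2, h1]
      ring)
  rcases hl with rfl | rfl | rfl
  · simp only [Complex.ofReal_zero, zero_mul, add_zero] at hfx
    have hfx' : ∀ v, f (v - x) = f v := fun v => by rw [← hfx (v - x), sub_add_cancel]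
    refine fatouSetOf_eq_of_affine (|b| + |x|) hf.continuous hgd.continuous fun n hn => ?_
    suffices h : (∀ z, g^[n] z = -f^[n] z + b) ∨ ∀ z, g^[n] z = f^[n] z - x by
      rcases h with h | h
      · exact ⟨-1, b, by simp, by simp, fun z => by rw [h]; ring⟩
      · exact ⟨1, -x, by simp, by simp, fun z => by rw [h]; ring⟩
    induction n, hn using Nat.le_induction with
    | base => left; intro z; simp [hg]
    | succ n _ ih =>
      rcases ih with ih | ih
      · right
        intro z
        rw [Function.iterate_succ_apply', ih, hg, hfL, Function.iterate_succ_apply']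
        ring
      · left
        intro z
        rw [Function.iterate_succ_apply', ih, hg, hfx', Function.iterate_succ_apply']
  · exfalso
    -- For `l = 1` the recursion gives `c n = n * x`, which is unbounded.
    have hcn : ∀ n, 1 ≤ n → c n = n * x := by
      intro n hn
      induction n, hn using Nat.le_induction with
      | base => simp [hc1]
      | succ n hn ih => rw [hrec n hn, ih]; push_cast; ring
    obtain ⟨n, hn⟩ := exists_nat_gt (B / |x|)
    rw [div_lt_iff₀ (abs_pos.2 hx)] at hn
    have h1 := hcB (n + 1) (by omega)
    rw [hcn (n + 1) (by omega), abs_mul, Nat.abs_cast] at h1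
    push_cast at h1
    linarith [abs_nonneg x]
  · have hper : ∀ (k : ℤ) v, f (v + k * x) = f v - k * x := by
      have hper1 : Function.Periodic (fun v => f v + v) (x : ℂ) := fun v => by
        simp only [hfx]
        push_cast
        ring
      intro k v
      have h1 := hper1.int_mul k v
      linear_combination h1
    have hgn : ∀ n : ℕ, ∃ k : ℤ, (∀ z, g^[n] z = f^[n] z + k * x) ∨
        ∀ z, g^[n] z = -(f^[n] z - k * x) + b := by
      intro n
      induction n with
      | zero => exact ⟨0, by simp⟩
      | succ n ih =>
        obtain ⟨k, ih | ih⟩ := ih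
        · refine ⟨k, Or.inr fun z => ?_⟩
          rw [Function.iterate_succ_apply', ih, hg, hper, Function.iterate_succ_apply']
        · refine ⟨k - 1, Or.inl fun z => ?_⟩
          rw [Function.iterate_succ_apply', ih, hg, Function.iterate_succ_apply', neg_sub,
            show k * (x : ℂ) - f^[n] z + b = -f^[n] z + b + k * x by ring, hper, hfL]
          push_cast
          ring
    refine (fatouSetOf_subset_of_int_translate |b| hf hxC (ε := -1) (by norm_num)
      (fun w => by rw [hfx]; simp) hna fun n _ => ?_).antisymm
      (fatouSetOf_subset_of_int_translate |b| hgd hxC (one_pow 2)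
        (fun w => by rw [hg, hg, hfx]; push_cast; ring) ?_ fun n _ => ?_)
    · obtain ⟨k, h | h⟩ := hgn n
      · exact ⟨1, 0, k, by simp, by simp, fun z => by rw [h]; ring⟩
      · exact ⟨-1, b, -k, by simp, by simp, fun z => by rw [h]; push_cast; ring⟩
    · rintro ⟨α, β, h⟩
      exact hna ⟨-α, b - β, fun z => by linear_combination hg z - h z⟩
    · obtain ⟨k, h | h⟩ := hgn n
      · exact ⟨1, 0, -k, by simp, by simp, fun z => by rw [h]; push_cast; ring⟩
      · exact ⟨-1, b, -k, by simp, by simp, fun z => by rw [h]; push_cast; ring⟩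

/-- If `f` commutes with the rotation `w ↦ a w + b`, then the iterates of `f` and of `g = a f + b`
differ by powers of the rotation, which are bounded because it has a fixed point. -/
theorem fatouSetOf_eq_of_rotation {f g : ℂ → ℂ} {a b : ℂ} (hf : Differentiable ℂ f)
    (ha : ‖a‖ = 1) (ha1 : a ≠ 1) (hg : ∀ z, g z = a * f z + b)
    (hfL : ∀ v, f (a * v + b) = a * f v + b) : fatouSetOf f = fatouSetOf g := by
  have hgd : Differentiable ℂ g := by
    rw [show g = fun z => a * f z + b from funext hg]
    fun_prop
  obtain ⟨p, hp⟩ : ∃ p, b = p - a * p := by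
    have : 1 - a ≠ 0 := sub_ne_zero.2 ha1.symm
    exact ⟨b / (1 - a), by field_simp⟩
  subst hp
  have hfn : ∀ (n : ℕ) w, f (a ^ n * w + (p - a ^ n * p)) = a ^ n * f w + (p - a ^ n * p) := by
    intro n
    induction n with
    | zero => simp
    | succ n ih =>
      intro w
      have h1 := hfL (a ^ n * w + (p - a ^ n * p))
      rw [ih] at h1
      rw [show a ^ (n + 1) * w + (p - a ^ (n + 1) * p) =
        a * (a ^ n * w + (p - a ^ n * p)) + (p - a * p) by ring, h1]
      ring
  have hgn : ∀ (n : ℕ) z, g^[n] z = a ^ n * f^[n] z + (p - a ^ n * p) := by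
    intro n
    induction n with
    | zero => simp
    | succ n ih =>
      intro z
      rw [Function.iterate_succ_apply', ih, hg, hfn, Function.iterate_succ_apply']
      ring
  refine fatouSetOf_eq_of_affine (‖p‖ + ‖p‖) hf.continuous hgd.continuous fun n _ =>
    ⟨a ^ n, p - a ^ n * p, by simp [ha], ?_, hgn n⟩
  refine (norm_sub_le _ _).trans ?_
  simp [ha]

theorem mainTheorem7 (f g : ℂ → ℂ) (hf : IsTranscendentalEntire f)
    (hg : IsTranscendentalEntire g) (a : ℂ) (b : ℝ) (ha : a ≠ 0) (hb : 0 < b)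
    (hgf : ∀ z, g z = a * f z + (b : ℂ))
    (hG : IsNearlyAbelian (generatedSemigroup {f, g}))
    (hΦ : semigroupCommutatorSet (generatedSemigroup {f, g}) ⊆
      {φ | ∃ c : ℝ, ∀ z, φ z = z + (c : ℂ)}) :
    fatouSetOf f = fatouSetOf g ∧ ‖a‖ = 1 := by
  have hfd := hf.1
  have hna : ¬ ∃ α β : ℂ, ∀ z, f z = α * z + β := by
    rintro ⟨α, β, h⟩
    exact hf.2 ⟨Polynomial.C α * Polynomial.X + Polynomial.C β, fun z => by simp [h]⟩
  have hopen : IsOpenMap f := isOpenMap_of_not_const hfd fun ⟨c, hc⟩ =>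
    hna ⟨0, c, fun z => by rw [hc]; ring⟩
  obtain ⟨B, hB⟩ := hG.exists_real_translation hΦ
  -- Cancelling `f` in the commutator of `f^[n]` with `g` relates `f^[n]` to `w ↦ a w + b`.
  have hex : ∀ n, 1 ≤ n → ∃ c : ℝ, |c| ≤ B ∧ ∀ v, f^[n] (a * v + b) = a * f^[n] v + b + c := by
    intro n hn
    obtain ⟨c, hcB, hc⟩ := hB (f^[n]) (iterate_mem_generatedSemigroup (by simp) hn) g
      (mem_generatedSemigroup_of_mem (by simp))
    refine ⟨c, hcB, fun v => congrFun (eq_of_comp_eq (u := fun v => f^[n] (a * v + b))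
      (v := fun v => a * f^[n] v + b + c) hopen ?_ ?_ fun z => ?_) v⟩
    · exact (hfd.iterate n).comp (by fun_prop)
    · exact (((hfd.iterate n).const_mul a).add_const _).add_const _
    · rw [← hgf, hc, hgf, ← Function.iterate_succ_apply' f n, Function.iterate_succ_apply]
  choose! c hcB hc using hex
  have hfL : ∀ v, f (a * v + b) = a * f v + b + c 1 := hc 1 le_rfl
  have hder : ∀ v, deriv f (a * v + b) = deriv f v := by
    intro v
    have h1 : HasDerivAt (fun v => a * v + (b : ℂ)) (a * 1) v :=
      ((hasDerivAt_id v).const_mul a).add_const _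
    have h2 := (hfd (a * v + b)).hasDerivAt.comp v h1
    have h3 : (f ∘ fun v => a * v + (b : ℂ)) = fun v => a * f v + b + c 1 := funext hfL
    rw [h3] at h2
    have h4 : HasDerivAt (fun v => a * f v + b + c 1) (a * deriv f v) v :=
      (((hfd v).hasDerivAt.const_mul a).add_const _).add_const _
    have h5 := h2.unique h4
    exact mul_left_cancel₀ ha (by linear_combination h5)
  -- If `‖a‖ ≠ 1`, then `w ↦ a w + b` or its inverse contracts to a fixed point, and `f'` is constant.
  have hanorm : ‖a‖ = 1 := by
    by_contra hne
    have h1a : 1 - a ≠ 0 := by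
      intro h
      rw [← sub_eq_zero.1 h, norm_one] at hne
      exact hne rfl
    refine hna (exists_affine_of_deriv_eq hfd (eq_of_scaling_invariant (p := b / (1 - a))
      hfd.deriv.continuous ha hne fun u => ?_))
    rw [← hder (b / (1 - a) + u)]
    congr 1
    field_simp
    ring
  refine ⟨?_, hanorm⟩
  -- Comparing the relations for `f^[n]` and `f^[n + 1]` makes each `c n` a pseudo-period of `f`.
  have hfc : ∀ n, 1 ≤ n → ∀ v, f (v + c n) = f v + (c (n + 1) - c 1 : ℝ) := by
    intro n hn v
    have h1 : (fun v => f (a * v + b + c n)) =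
        fun v => f (a * v + b) + ((c (n + 1) - c 1 : ℝ) : ℂ) := by
      refine eq_of_comp_eq (f := f^[n]) (isOpenMap_iterate hopen n) (by fun_prop) (by fun_prop) fun z => ?_
      rw [← hc n hn, ← Function.iterate_succ_apply' f n, hc (n + 1) (by omega), hfL,
        Function.iterate_succ_apply']
      push_cast
      ring
    have h2 := congrFun h1 ((v - b) / a)
    simp only [mul_div_cancel₀ _ ha, sub_add_cancel] at h2
    exact h2
  by_cases hc1 : c 1 = 0
  · by_cases ha1 : a = 1
    · subst ha1
      refine fatouSetOf_eq_of_add (l := 1) (B := B) hfd hna hb.ne' (fun z => by rw [hgf, one_mul])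
        (fun v => ?_) (fun n hn => ⟨c n, hcB n hn, fun v => ?_⟩)
      · have := hfL v
        simpa [hc1] using this
      · simpa using hc n hn v
    · exact fatouSetOf_eq_of_rotation hfd hanorm ha1 hgf fun v => by simpa [hc1] using hfL v
  · have hc1C : (c 1 : ℂ) ≠ 0 := Complex.ofReal_ne_zero.2 hc1
    have hfx := hfc 1 le_rfl
    -- If `a` were not real, `f'` would be doubly periodic.
    have haim : a.im = 0 := by
      by_contra him
      have hper := deriv_periodic_of_add_eq hfx
      have hper' : Function.Periodic (deriv f) (a * c 1) := by
        intro v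
        have h1 := hder ((v - b) / a + c 1)
        have h2 := hder ((v - b) / a)
        rw [hper, ← h2, mul_add, mul_div_cancel₀ _ ha, sub_add_cancel,
          show v - b + a * c 1 + (b : ℂ) = v + a * c 1 by ring] at h1
        exact h1
      obtain ⟨k, hk⟩ := exists_const_of_periodic_of_periodic hfd.deriv hc1C him hper hper'
      exact hna (exists_affine_of_deriv_eq hfd hk)
    have hare : a = (a.re : ℂ) := Complex.ext rfl (by simp [haim])
    have habs : |a.re| = 1 := by
      rw [hare, Complex.norm_real] at hanorm
      exact hanorm
    rcases eq_or_eq_neg_of_abs_eq habs with h | h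
    · have ha1 : a = 1 := by rw [hare, h, Complex.ofReal_one]
      subst ha1
      refine fatouSetOf_eq_of_add (l := (b + c 1) / b) (B := B) hfd hna hb.ne'
        (fun z => by rw [hgf, one_mul]) (fun v => ?_) (fun n hn => ⟨c n, hcB n hn, fun v => ?_⟩)
      · have hbC : (b : ℂ) ≠ 0 := Complex.ofReal_ne_zero.2 hb.ne'
        have := hfL v
        rw [one_mul, one_mul] at this
        rw [this]
        push_cast
        field_simp
        ring
      · simpa using hc n hn v
    · have ha1 : a = -1 := by rw [hare, h]; simp
      subst ha1
      refine fatouSetOf_eq_of_neg_add (x := c 1) (l := (c 2 - c 1) / c 1) (B := B) (b := b) hfd hna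
        hc1 (fun z => by rw [hgf]; ring) (fun v => ?_) (fun v => ?_) c rfl hcB hfc
      · have := hfL v
        simpa using this
      · rw [hfx]
        push_cast
        field_simp
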